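/- Let $d\ge 1$ be an integer, $\beta>d/2$, $Q>0$ and $a_0>0$. Let $X_1,\dots,X_n$ be i.i.d. random vectors in $\mathbb R^d$ with unknown density $p$. For an estimator $\hat p$ based on $X_1,\dots,X_n$ put $R_n(\hat p,p)=E_p\|\hat p-p\|^2$, where $\|\cdot\|$ is the norm of $L_2(\mathbb R^d)$. Let $$\Theta(\beta,Q)=\Big\{p:\mathbb R^d\to\mathbb R \;\Big|\; p\ge 0,\ \int_{\mathbb R^d} p=1,\ \int_{\mathbb R^d}\|t\|_d^{2\beta}|\varphi(t)|^2dt\le Q\Big\},\qquad \varphi(t)=\int_{\mathbb R^d} e^{i x^Tt}p(x)\,dx ,$$ where $\|\cdot\|_d$ is the Euclidean norm. Let $K_\beta$ be the Pinsker kernel, the continuous function in $L_2(\mathbb R^d)$ with Fourier transform $(1-\|t\|_d^\beta)_+$, that is $$K_\beta(x)=(2\pi)^{-d}\int_{\mathbb R^d}e^{-ix^Tt}(1-\|t\|_d^\beta)_+\,dt .$$ *Kernel estimators.* Let $m=\lfloor n(1-1/\log n)\rfloor$, $\ell=n-m$, $h_0=(n\log n)^{-1/d}$, $a_n=a_0/\log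 n$, $M=2+\max\{j\in\mathbb N: h_0(1+a_n)^j<1\}$, $h_j=(1+a_n)^jh_0$ for $1\le j\le M-2$, and $h_{M-1}=1$. For a sample $Y_1,\dots,Y_m$ and $h>0$ put $\hat p_{m,h}(x)=\frac1{mh^d}\sum_{i=1}^m K_\beta\big(\frac{Y_i-x}{h}\big)$. *Aggregates.* Let $p_1,\dots,p_M\in L_2(\mathbb R^d)$ be functions, $p_\lambda=\sum_{j}\lambda_jp_j$ for $\lambda\in\mathbb R^M$, and let $Y_1,\dots,Y_\ell$ be a sample. The linear aggregate is $\sum_{j=1}^{M'}\big(\frac1\ell\sum_{i=1}^\ell\phi_j(Y_i)\big)\phi_j$, where $\phi_1,\dots,\phi_{M'}$ is an orthonormal basis in $L_2(\mathbb R^d)$ of the linear span of $p_1,\dots,p_M$. The convex aggregate is $p_{\hat\lambda}$, where $\hat\lambda$ minimizes $\|p_\lambda\|^2-\frac2\ell\sum_{i=1}^\ell p_\lambda(Y_i)$ over $\Lambda^M=\{\lambda\in\mathbb R^M:\lambda_j\ge0,\ \sum_j\lambda_j\le1\}$. *Averaging.* A split divides $(X_1,\dots,X_n)$ into a training sample of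 size $m$ and a validation sample of size $\ell$. For each $n$ (large enough for these quantities to be meaningful) let $\mathbf S=\mathbf S_n$ be an arbitrary non-empty finite set of splits. The averaged linear (respectively convex) kernel aggregate $\tilde p_n^{\mathbf S,K_\beta}$ is the average over $\mathcal S\in\mathbf S$ of the linear (respectively convex) aggregates, based on the validation sample of $\mathcal S$, of the functions $p_j=\hat p_{m,h_{j-1}}$, $j=1,\dots,M$, computed from the training sample of $\mathcal S$. **Corollary 6.1.** For the averaged linear kernel aggregate and for the averaged convex kernel aggregate, $$\sup_{p\in\Theta(\beta,Q)}R_n(\tilde p_n^{\mathbf S,K_\beta},p)\le C^*\,n^{-\frac{2\beta}{2\beta+d}}(1+o(1)),\qquad n\to\infty,$$ where the $o(1)$ depends only on $n,d,\beta,Q,a_0$ (it is uniform over the choice of $\mathbf S$), and $$C^*=\frac{[Q(2\beta+d)]^{\frac d{2\beta+d}}}{d(2\pi)^d}\Big(\frac{\beta S_d}{\beta+d}\Big)^{\frac{2\beta}{2\beta+d}},\qquad S_d=\frac{2\pi^{d/2}}{\Gamma(d/2)} .$$ -/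

import Mathlib

open MeasureTheory Filter Topology
open scoped ENNReal

noncomputable section

namespace DensityAgg

/-! ### Risk -/

/-- The law on `ℝ^d` with Lebesgue density `p`. -/
def law {d : ℕ} (p : EuclideanSpace ℝ (Fin d) → ℝ) : Measure (EuclideanSpace ℝ (Fin d)) :=
  volume.withDensity fun x => ENNReal.ofReal (p x)

/-- The mean squared risk `E ‖p̂ - p‖²`, where the sample `X` consists of `n` i.i.d. points with
density `p` and `‖·‖` is the norm of `L₂(ℝ^d)`. It is computed in `[0, ∞]`. -/
def risk {d n : ℕ}
    (phat : (Fin n → EuclideanSpace ℝ (Fin d)) → EuclideanSpace ℝ (Fin d) → ℝ)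
    (p : EuclideanSpace ℝ (Fin d) → ℝ) : ℝ≥0∞ :=
  ∫⁻ X, (∫⁻ x, ENNReal.ofReal ((phat X x - p x) ^ 2)) ∂(Measure.pi fun _ : Fin n => law p)

/-! ### Linear and convex aggregates of fixed functions -/

/-- The combination `∑ j, w j • p j`. -/
def combination {d M : ℕ} (p : Fin M → EuclideanSpace ℝ (Fin d) → ℝ) (w : Fin M → ℝ) :
    EuclideanSpace ℝ (Fin d) → ℝ :=
  fun x => ∑ j, w j * p j x

/-- `g` is the linear aggregate of `p 1, …, p M` based on the sample `Y 1, …, Y l`: it is the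
empirical projection onto the linear span of the `p j`, computed in an orthonormal basis `φ` of
that span for the scalar product of `L₂(ℝ^d)`. -/
def IsLinearAggregate {d M l : ℕ} (p : Fin M → EuclideanSpace ℝ (Fin d) → ℝ)
    (Y : Fin l → EuclideanSpace ℝ (Fin d)) (g : EuclideanSpace ℝ (Fin d) → ℝ) : Prop :=
  ∃ (M' : ℕ) (φ : Fin M' → EuclideanSpace ℝ (Fin d) → ℝ),
    (∀ j, MemLp (φ j) 2 volume) ∧
    (∀ j k, (∫ x, φ j x * φ k x) = if j = k then 1 else 0) ∧
    Submodule.span ℝ (Set.range φ) = Submodule.span ℝ (Set.range p) ∧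
    g = fun x => ∑ j, ((1 / (l : ℝ)) * ∑ i, φ j (Y i)) * φ j x

/-- The set of nonnegative weights with sum at most one. -/
def subSimplex (M : ℕ) : Set (Fin M → ℝ) :=
  {w | (∀ j, 0 ≤ w j) ∧ ∑ j, w j ≤ 1}

/-- The empirical criterion `‖p_w‖² - (2 / l) ∑ i, p_w (Y i)`. -/
def criterion {d M l : ℕ} (p : Fin M → EuclideanSpace ℝ (Fin d) → ℝ)
    (Y : Fin l → EuclideanSpace ℝ (Fin d)) (w : Fin M → ℝ) : ℝ :=
  (∫ x, combination p w x ^ 2) - (2 / (l : ℝ)) * ∑ i, combination p w (Y i)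

/-- `g` is the convex aggregate of `p 1, …, p M` based on the sample `Y 1, …, Y l`: its vector of
weights minimizes the empirical criterion over `subSimplex M`. -/
def IsConvexAggregate {d M l : ℕ} (p : Fin M → EuclideanSpace ℝ (Fin d) → ℝ)
    (Y : Fin l → EuclideanSpace ℝ (Fin d)) (g : EuclideanSpace ℝ (Fin d) → ℝ) : Prop :=
  ∃ w ∈ subSimplex M, IsMinOn (criterion p Y) (subSimplex M) w ∧ g = combination p w

/-- The two kinds of aggregates. -/
inductive Kind
  | linear
  | convex

/-- `g` is the linear, respectively convex, aggregate of the `p j` based on the sample `Y`. -/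
def IsAggregate {d M l : ℕ} (kind : Kind) (p : Fin M → EuclideanSpace ℝ (Fin d) → ℝ)
    (Y : Fin l → EuclideanSpace ℝ (Fin d)) (g : EuclideanSpace ℝ (Fin d) → ℝ) : Prop :=
  match kind with
  | Kind.linear => IsLinearAggregate p Y g
  | Kind.convex => IsConvexAggregate p Y g

/-! ### Kernel estimators and the grid of bandwidths -/

/-- The kernel density estimator with kernel `K` and bandwidth `h`, based on the sample `Y`. -/
def kernelEstimator {d m : ℕ} (K : EuclideanSpace ℝ (Fin d) → ℝ) (h : ℝ)
    (Y : Fin m → EuclideanSpace ℝ (Fin d)) : EuclideanSpace ℝ (Fin d) → ℝ :=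
  fun x => (1 / ((m : ℝ) * h ^ d)) * ∑ i, K (h⁻¹ • (Y i - x))

/-- The smallest bandwidth `h₀ = (n log n)^{-1/d}`. -/
def minBandwidth (d n : ℕ) : ℝ := ((n : ℝ) * Real.log n) ^ (-1 / (d : ℝ))

/-- The relative step `a_n = a₀ / log n` of the grid. -/
def gridStep (a₀ : ℝ) (n : ℕ) : ℝ := a₀ / Real.log n

/-- The number `M` of bandwidths: `M - 2 = max {j : h₀ (1 + a_n)^j < 1}`. -/
def gridSize (d : ℕ) (a₀ : ℝ) (n : ℕ) : ℕ :=
  sSup {j : ℕ | minBandwidth d n * (1 + gridStep a₀ n) ^ j < 1} + 2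

/-- The bandwidths `h_j = (1 + a_n)^j h₀` for `0 ≤ j ≤ M - 2`, and `h_{M-1} = 1`. -/
def bandwidth (d : ℕ) (a₀ : ℝ) (n : ℕ) (j : Fin (gridSize d a₀ n)) : ℝ :=
  if (j : ℕ) + 1 = gridSize d a₀ n then 1 else (1 + gridStep a₀ n) ^ (j : ℕ) * minBandwidth d n

/-! ### Sample splitting and averaged aggregates -/

/-- The size `m = ⌊n (1 - 1 / log n)⌋` of the training sample. -/
def trainSize (n : ℕ) : ℕ := ⌊(n : ℝ) * (1 - 1 / Real.log n)⌋₊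

/-- The size `l = n - m` of the validation sample. -/
def validSize (n : ℕ) : ℕ := n - trainSize n

/-- A split of `n` observations: a partition of the indices into a training sample of size
`trainSize n` and a validation sample of size `validSize n`, both enumerated. -/
abbrev Split (n : ℕ) : Type := Fin (trainSize n) ⊕ Fin (validSize n) ≃ Fin n

/-- The training sample of a split. -/
def training {d n : ℕ} (s : Split n) (X : Fin n → EuclideanSpace ℝ (Fin d)) :
    Fin (trainSize n) → EuclideanSpace ℝ (Fin d) :=
  fun i => X (s (Sum.inl i))

/-- The validation sample of a split. -/
def validation {d n : ℕ} (s : Split n) (X : Fin n → EuclideanSpace ℝ (Fin d)) :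
    Fin (validSize n) → EuclideanSpace ℝ (Fin d) :=
  fun i => X (s (Sum.inr i))

/-- `ptilde` is the averaged linear (or convex) kernel aggregate with kernel `K` over the set of
splits `S`: for every sample `X` it is the average over `s ∈ S` of the aggregates based on the
validation sample of `s` of the kernel estimators based on the training sample of `s`, whose
bandwidths run through the grid. -/
def IsAveragedKernelAggregate {d n : ℕ} (kind : Kind) (K : EuclideanSpace ℝ (Fin d) → ℝ) (a₀ : ℝ)
    (S : Finset (Split n))
    (ptilde : (Fin n → EuclideanSpace ℝ (Fin d)) → EuclideanSpace ℝ (Fin d) → ℝ) : Prop :=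
  ∀ X : Fin n → EuclideanSpace ℝ (Fin d),
    ∃ q : Split n → EuclideanSpace ℝ (Fin d) → ℝ,
      (∀ s ∈ S, IsAggregate kind
        (fun j => kernelEstimator K (bandwidth d a₀ n j) (training s X)) (validation s X) (q s)) ∧
      ptilde X = fun x => (1 / (S.card : ℝ)) * ∑ s ∈ S, q s x

/-! ### Sobolev classes and the Pinsker kernel -/

/-- The Fourier transform `∫ exp(i ⟨x, t⟩) f(x) dx` of an integrable function `f`. -/
def fourier {d : ℕ} (f : EuclideanSpace ℝ (Fin d) → ℝ) (t : EuclideanSpace ℝ (Fin d)) : ℂ :=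
  ∫ x, Complex.exp (Complex.I * ((inner ℝ x t : ℝ) : ℂ)) * (f x : ℂ)

/-- The Sobolev class of probability densities on `ℝ^d`. The condition `∫ p = 1` contains the
integrability of `p`; the Sobolev condition is an inequality in `[0, ∞]`. -/
def sobolevClass (d : ℕ) (β Q : ℝ) : Set (EuclideanSpace ℝ (Fin d) → ℝ) :=
  {p | (∀ x, 0 ≤ p x) ∧ (∫ x, p x) = 1 ∧
    (∫⁻ t, ENNReal.ofReal (‖t‖ ^ (2 * β) * ‖fourier p t‖ ^ 2)) ≤ ENNReal.ofReal Q}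

/-- The Fourier transform `(1 - ‖t‖^β)₊` of the Pinsker kernel. -/
def pinskerFourier {d : ℕ} (β : ℝ) (t : EuclideanSpace ℝ (Fin d)) : ℝ := max (1 - ‖t‖ ^ β) 0

/-- The Pinsker kernel: the (continuous, square integrable) function on `ℝ^d` whose Fourier
transform in the sense of `L₂(ℝ^d)` is `pinskerFourier β`, given by the inversion formula
`K(x) = (2π)^{-d} ∫ exp(-i ⟨x, t⟩) (1 - ‖t‖^β)₊ dt`. The integral is real because
`pinskerFourier β` is even. -/
def pinskerKernel (d : ℕ) (β : ℝ) (x : EuclideanSpace ℝ (Fin d)) : ℝ :=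
  (((2 * Real.pi) ^ d)⁻¹ : ℝ) *
    (∫ t : EuclideanSpace ℝ (Fin d),
      Complex.exp (-(Complex.I * ((inner ℝ x t : ℝ) : ℂ))) * (pinskerFourier β t : ℂ)).re

/-- The surface area `S_d = 2 π^{d/2} / Γ(d/2)` of the unit sphere of `ℝ^d`. -/
def sphereArea (d : ℕ) : ℝ := 2 * Real.pi ^ ((d : ℝ) / 2) / Real.Gamma ((d : ℝ) / 2)

/-- The constant `C* = [Q(2β+d)]^{d/(2β+d)} / (d (2π)^d) · (β S_d / (β+d))^{2β/(2β+d)}`. -/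
def pinskerConst (d : ℕ) (β Q : ℝ) : ℝ :=
  (Q * (2 * β + d)) ^ ((d : ℝ) / (2 * β + d)) / ((d : ℝ) * (2 * Real.pi) ^ d) *
    (β * sphereArea d / (β + d)) ^ (2 * β / (2 * β + d))

end DensityAgg

end

/-! Since $\beta>d/2$, the Sobolev condition makes the characteristic function integrable. Every $p$
in the class then agrees a.e. with its continuous inverse transform $q$, bounded by a constant $L$
uniform over the class (`abs_reFourierInv_fourier_le`).

Oracle inequality: freeze the training sample of a split and compare the aggregate $g$ with one
estimator $f_k$. With $u=g-f_k$ and $P_\ell$ the validation mean, both kinds satisfy $\langle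
g,u\rangle\le P_\ell u$: the linear aggregate by its normal equations, the convex one by first-order
optimality towards a vertex. Expanding the square gives $\|g-q\|^2\le\|f_k-q\|^2+2(P_\ell u-\langle
u,q\rangle)-\|u\|^2$. Over the whole span the excess is at most the sum of the squared deviations of
the empirical coefficients in an orthonormal basis, with mean at most $ML/\ell$
(`lintegral_fluctuation_le`). Averaging over splits costs nothing, by convexity of the square.

Kernel risk: by Plancherel and $1-(1-\|t\|^\beta)_+\le\|t\|^\beta$, bandwidth $h$ has risk at most
$(2\pi)^{-d}\big(Qh^{2\beta}+(mh^d)^{-1}I\big)$, where $I=\int(1-\|t\|^\beta)_+^2$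
(`lintegral_kernelEstimator_sub_sq_le`). With $n$ in place of $m$, the minimum over $h$ is exactly
$C^*n^{-2\beta/(2\beta+d)}$ (`pinskerConst_eq`). The minimizer $h^*$ depends only on $n$ and the
class, and the grid has $h_k\le h^*\le(1+a_n)h_k$: the bias does not grow and the variance grows by
a factor at most $(1+a_n)^d\to1$. Finally $m/n\to1$ and $ML/\ell=O(\log^3 n/n)$ is negligible. -/

noncomputable section

namespace DensityAgg

/-! ### Plancherel and inversion for Fourier integrals -/

section Plancherel

open FourierTransform SchwartzMap
open scoped ContDiff

variable {V : Type*} [NormedAddCommGroup V] [InnerProductSpace ℝ V] [FiniteDimensional ℝ V]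
  [MeasurableSpace V] [BorelSpace V]

theorem continuous_fourierIntegral {f : V → ℂ} (hf : Integrable f) : Continuous (𝓕 f) :=
  VectorFourier.fourierIntegral_continuous Real.continuous_fourierChar
    (by exact continuous_inner) hf

theorem integral_smul_fourierIntegral {f g : V → ℂ} (hf : Integrable f) (hg : Integrable g) :
    ∫ x, g x • 𝓕 f x = ∫ x, 𝓕 g x • f x := by
  have h := VectorFourier.integral_fourierIntegral_smul_eq_flip (L := innerₗ V) (μ := volume)
    (ν := volume) Real.continuous_fourierChar (by exact continuous_inner) hg hf
  rw [flip_innerₗ] at h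
  exact h.symm

theorem lintegral_comp_smul {r : ℝ} (hr : r ≠ 0) (f : V → ℝ≥0∞) :
    ∫⁻ x, f (r • x) = ENNReal.ofReal |(r ^ Module.finrank ℝ V)⁻¹| * ∫⁻ x, f x := by
  have h := (Homeomorph.smulOfNeZero (α := V) r hr).measurableEmbedding.lintegral_map
    (μ := volume) f
  simp only [Homeomorph.smulOfNeZero_apply] at h
  rw [← h]
  change ∫⁻ x, f x ∂(Measure.map (fun x => r • x) volume) = _
  rw [Measure.map_addHaar_smul _ hr, lintegral_smul_measure, smul_eq_mul]

theorem eLpNorm_two_sq {α : Type*} [MeasurableSpace α] {μ : Measure α} {F : Type*}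
    [NormedAddCommGroup F] (f : α → F) :
    eLpNorm f 2 μ ^ 2 = ∫⁻ x, ‖f x‖ₑ ^ 2 ∂μ := by
  have := eLpNorm_nnreal_pow_eq_lintegral (f := f) (μ := μ) (p := 2) (by norm_num)
  simpa using this

/-- Both sides are tested against smooth compactly supported functions. The $L^2$ transform is the
distributional one, so it moves onto the test function, and the multiplication formula moves it back
onto $f$. -/
theorem fourier_toLp_ae_eq {f : V → ℂ} (hf : Integrable f) (h2 : MemLp f 2) :
    (𝓕 (h2.toLp f) : Lp ℂ 2 (volume : Measure V)) =ᵐ[volume] 𝓕 f := by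
  apply ae_eq_of_integral_contDiff_smul_eq
  · exact (Lp.memLp _).locallyIntegrable (by norm_num)
  · exact (continuous_fourierIntegral hf).locallyIntegrable
  · intro g g_smooth g_cpt
    have hg₁ : HasCompactSupport (Complex.ofRealCLM ∘ g) := g_cpt.comp_left rfl
    have hg₂ : ContDiff ℝ ∞ (Complex.ofRealCLM ∘ g) := by fun_prop
    set G := hg₁.toSchwartzMap hg₂ with hG
    have hGx : ∀ x, G x = (g x : ℂ) := fun x => by simp [hG]
    have e1 : ∫ x, g x • (𝓕 (h2.toLp f) : Lp ℂ 2 (volume : Measure V)) x =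
        Lp.toTemperedDistribution (𝓕 (h2.toLp f) : Lp ℂ 2 (volume : Measure V)) G := by
      rw [Lp.toTemperedDistribution_apply]
      simp only [hGx]; rfl
    rw [e1, ← Lp.fourier_toTemperedDistribution_eq, TemperedDistribution.fourier_apply,
      Lp.toTemperedDistribution_apply]
    have e2 : ∫ x, (𝓕 G) x • (h2.toLp f) x = ∫ x, (𝓕 (G : V → ℂ)) x • f x := by
      apply integral_congr_ae
      filter_upwards [h2.coeFn_toLp] with x hx
      rw [hx, SchwartzMap.fourier_coe]
    rw [e2, ← integral_smul_fourierIntegral hf G.integrable]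
    simp only [hGx]; rfl

/-- Plancherel's theorem for the Fourier integral of a function in `L¹ ∩ L²`. -/
theorem lintegral_enorm_fourier_sq {f : V → ℂ} (hf : Integrable f) (h2 : MemLp f 2) :
    ∫⁻ x, ‖𝓕 f x‖ₑ ^ 2 = ∫⁻ x, ‖f x‖ₑ ^ 2 := by
  rw [← eLpNorm_two_sq, ← eLpNorm_two_sq, ← eLpNorm_congr_ae (fourier_toLp_ae_eq hf h2),
    ← Lp.enorm_def, ← eLpNorm_congr_ae h2.coeFn_toLp, ← Lp.enorm_def]
  congr 1
  rw [← ofReal_norm, ← ofReal_norm, Lp.norm_fourier_eq]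

/-- Fourier inversion almost everywhere, without continuity. -/
theorem ae_eq_fourierInv_fourier {f : V → ℂ} (hf : Integrable f) (hF : Integrable (𝓕 f)) :
    f =ᵐ[volume] 𝓕⁻ (𝓕 f) := by
  have hc : Continuous (𝓕⁻ (𝓕 f)) := by
    have : 𝓕⁻ (𝓕 f) = fun x => 𝓕 (𝓕 f) (-x) := by
      ext x; rw [Real.fourierInv_eq_fourier_neg]
    rw [this]
    exact (continuous_fourierIntegral hF).comp continuous_neg
  apply ae_eq_of_integral_contDiff_smul_eq
  · exact hf.locallyIntegrable
  · exact hc.locallyIntegrable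
  · intro g g_smooth g_cpt
    have hg₁ : HasCompactSupport (Complex.ofRealCLM ∘ g) := g_cpt.comp_left rfl
    have hg₂ : ContDiff ℝ ∞ (Complex.ofRealCLM ∘ g) := by fun_prop
    set G := hg₁.toSchwartzMap hg₂ with hG
    have hGx : ∀ x, G x = (g x : ℂ) := fun x => by simp [hG]
    -- $H$ is chosen with $\mathcal F H=G$, so that two uses of the multiplication formula turn
    -- $\int Gf$ into $\int H\,\mathcal Ff$ and then into $\int G\,\mathcal F^{-1}\mathcal Ff$.
    set H : 𝓢(V, ℂ) := 𝓕⁻ G with hH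
    have h1 : ∀ x, 𝓕 (⇑H) x = G x := fun x => by
      rw [← SchwartzMap.fourier_coe, hH, fourier_fourierInv_eq]
    have e1 := integral_smul_fourierIntegral hf H.integrable
    simp only [h1] at e1
    have e2 : ∫ x, H x • 𝓕 f x = ∫ x, G x • 𝓕⁻ (𝓕 f) x := by
      simp only [Real.fourierInv_eq_fourier_neg]
      have e4 := integral_smul_fourierIntegral hF (G.integrable.comp_neg)
      have e5 : ∀ x, 𝓕 (fun x => G (-x)) x = H x := fun x => by
        rw [hH, SchwartzMap.fourierInv_coe, Real.fourierInv_eq', Real.fourier_eq',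
          ← integral_neg_eq_self]
        simp
      simp only [e5] at e4
      rw [← e4, ← integral_neg_eq_self]
      simp
    have := e1.symm.trans e2
    simp only [hGx] at this
    exact this

end Plancherel

theorem memLp_two_of_integrable_of_bound {α F : Type*} [MeasurableSpace α] {μ : Measure α}
    [NormedAddCommGroup F] {f : α → F} (hf : Integrable f μ) {C : ℝ} (hC : ∀ x, ‖f x‖ ≤ C) :
    MemLp f 2 μ := by
  rw [memLp_two_iff_integrable_sq_norm hf.1]
  refine (hf.norm.const_mul C).mono' (hf.1.norm.pow 2) (ae_of_all _ fun x => ?_)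
  rw [Real.norm_of_nonneg (by positivity), sq]
  exact mul_le_mul_of_nonneg_right (hC x) (norm_nonneg _)

/-! ### The same facts for the convention $\int e^{i\langle x,t\rangle}f(x)\,dx$ -/

section Inversion

open FourierTransform

variable {d : ℕ}

/-- The real part of the inverse Fourier transform, in the normalization of `fourier`. -/
def reFourierInv (g : EuclideanSpace ℝ (Fin d) → ℂ) (x : EuclideanSpace ℝ (Fin d)) : ℝ :=
  (((2 * Real.pi) ^ d)⁻¹ : ℝ) *
    (∫ t : EuclideanSpace ℝ (Fin d),
      Complex.exp (-(Complex.I * ((inner ℝ x t : ℝ) : ℂ))) * g t).re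

theorem integral_exp_neg_inner_mul (g : EuclideanSpace ℝ (Fin d) → ℂ)
    (x : EuclideanSpace ℝ (Fin d)) :
    ∫ t, Complex.exp (-(Complex.I * ((inner ℝ x t : ℝ) : ℂ))) * g t =
      𝓕 g ((2 * Real.pi)⁻¹ • x) := by
  rw [Real.fourier_eq']
  congr 1; ext t
  rw [smul_eq_mul, real_inner_smul_right, real_inner_comm]
  congr 2
  push_cast
  have : (Real.pi : ℂ) ≠ 0 := by exact_mod_cast Real.pi_ne_zero
  field_simp

theorem fourier_eq_fourierInv (f : EuclideanSpace ℝ (Fin d) → ℝ) (t : EuclideanSpace ℝ (Fin d)) :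
    fourier f t = 𝓕 (fun x => (f x : ℂ)) ((-(2 * Real.pi)⁻¹) • t) := by
  rw [fourier, Real.fourier_eq']
  congr 1; ext x
  rw [smul_eq_mul, real_inner_smul_right]
  congr 2
  push_cast
  have : (Real.pi : ℂ) ≠ 0 := by exact_mod_cast Real.pi_ne_zero
  field_simp

theorem norm_exp_neg_I_mul (r : ℝ) : ‖Complex.exp (-(Complex.I * (r : ℂ)))‖ = 1 := by
  rw [Complex.norm_exp]; simp

theorem norm_exp_I_mul (r : ℝ) : ‖Complex.exp (Complex.I * (r : ℂ))‖ = 1 := by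
  rw [Complex.norm_exp]; simp

theorem integrable_exp_neg_inner_mul {g : EuclideanSpace ℝ (Fin d) → ℂ} (hg : Integrable g)
    (x : EuclideanSpace ℝ (Fin d)) :
    Integrable fun t => Complex.exp (-(Complex.I * ((inner ℝ x t : ℝ) : ℂ))) * g t :=
  hg.bdd_mul (c := 1) (by fun_prop) (ae_of_all _ fun t => (norm_exp_neg_I_mul _).le)

theorem continuous_reFourierInv {g : EuclideanSpace ℝ (Fin d) → ℂ} (hg : Integrable g) :
    Continuous (reFourierInv g) := by
  unfold reFourierInv
  simp only [integral_exp_neg_inner_mul]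
  have := continuous_fourierIntegral hg
  fun_prop

theorem abs_reFourierInv_le (g : EuclideanSpace ℝ (Fin d) → ℂ) (x : EuclideanSpace ℝ (Fin d)) :
    |reFourierInv g x| ≤ ((2 * Real.pi) ^ d)⁻¹ * ∫ t, ‖g t‖ := by
  have hpi := Real.pi_pos
  rw [reFourierInv, abs_mul, abs_of_pos (by positivity)]
  gcongr
  refine (Complex.abs_re_le_norm _).trans ((norm_integral_le_integral_norm _).trans_eq ?_)
  simp only [norm_mul, norm_exp_neg_I_mul, one_mul]

theorem reFourierInv_sub {g g' : EuclideanSpace ℝ (Fin d) → ℂ} (hg : Integrable g)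
    (hg' : Integrable g') (x : EuclideanSpace ℝ (Fin d)) :
    reFourierInv (fun t => g t - g' t) x = reFourierInv g x - reFourierInv g' x := by
  simp only [reFourierInv, mul_sub]
  rw [integral_sub (integrable_exp_neg_inner_mul hg x) (integrable_exp_neg_inner_mul hg' x),
    Complex.sub_re, mul_sub]

/-- Plancherel after the dilation by $(2\pi)^{-1}$. Only an inequality is needed, and the imaginary
part is discarded. -/
theorem lintegral_reFourierInv_sq_le {g : EuclideanSpace ℝ (Fin d) → ℂ} (hg : Integrable g)
    (h2 : MemLp g 2) :
    ∫⁻ x, ENNReal.ofReal (reFourierInv g x ^ 2) ≤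
      ENNReal.ofReal (((2 * Real.pi) ^ d)⁻¹) * ∫⁻ t, ‖g t‖ₑ ^ 2 := by
  have hpi := Real.pi_pos
  set c : ℝ := (2 * Real.pi) ^ d with hc
  have hc0 : 0 < c := by positivity
  calc ∫⁻ x, ENNReal.ofReal (reFourierInv g x ^ 2)
      ≤ ∫⁻ x, ENNReal.ofReal (c⁻¹ ^ 2) * ‖𝓕 g ((2 * Real.pi)⁻¹ • x)‖ₑ ^ 2 := by
        refine lintegral_mono fun x => ?_
        rw [reFourierInv, integral_exp_neg_inner_mul, mul_pow, ENNReal.ofReal_mul (by positivity),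
          ← hc, ← ofReal_norm, ← ENNReal.ofReal_pow (norm_nonneg _)]
        refine mul_le_mul_right (ENNReal.ofReal_le_ofReal ?_) _
        rw [← sq_abs]
        exact pow_le_pow_left₀ (abs_nonneg _) (Complex.abs_re_le_norm _) 2
    _ = ENNReal.ofReal c⁻¹ * ∫⁻ t, ‖g t‖ₑ ^ 2 := by
        rw [lintegral_const_mul' _ _ ENNReal.ofReal_ne_top,
          lintegral_comp_smul (by positivity) (fun y => ‖𝓕 g y‖ₑ ^ 2),
          lintegral_enorm_fourier_sq hg h2, ← mul_assoc, ← ENNReal.ofReal_mul (by positivity)]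
        congr 2
        rw [finrank_euclideanSpace_fin, inv_pow, inv_pow, inv_inv, ← hc, abs_of_pos hc0]
        field_simp

theorem continuous_fourier {f : EuclideanSpace ℝ (Fin d) → ℝ} (hf : Integrable f) :
    Continuous (fourier f) := by
  have := continuous_fourierIntegral (f := fun x => (f x : ℂ)) hf.ofReal
  have h : fourier f = _ := funext (fourier_eq_fourierInv f)
  rw [h]
  fun_prop

theorem norm_fourier_le {f : EuclideanSpace ℝ (Fin d) → ℝ} (t : EuclideanSpace ℝ (Fin d)) :
    ‖fourier f t‖ ≤ ∫ x, ‖f x‖ := by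
  refine (norm_integral_le_integral_norm _).trans_eq ?_
  simp only [norm_mul, norm_exp_I_mul, one_mul, Complex.norm_real]

/-- The right-hand side is a continuous version of $f$; it replaces the density wherever continuity
or a pointwise bound is needed. -/
theorem ae_eq_reFourierInv_fourier {f : EuclideanSpace ℝ (Fin d) → ℝ} (hf : Integrable f)
    (hF : Integrable (fourier f)) : f =ᵐ[volume] reFourierInv (fourier f) := by
  have hpi := Real.pi_pos
  set f' : EuclideanSpace ℝ (Fin d) → ℂ := fun x => (f x : ℂ) with hf'
  have hFe : ∀ y, 𝓕 f' y = fourier f ((-(2 * Real.pi)) • y) := fun y => by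
    rw [fourier_eq_fourierInv, smul_smul]
    rw [show -(2 * Real.pi)⁻¹ * -(2 * Real.pi) = 1 by field_simp, one_smul]
  have hF' : Integrable (𝓕 f') := by
    have : Integrable fun y => fourier f ((-(2 * Real.pi)) • y) :=
      hF.comp_smul (by linarith [Real.pi_pos])
    exact this.congr (ae_of_all _ fun y => (hFe y).symm)
  filter_upwards [ae_eq_fourierInv_fourier hf.ofReal hF'] with x hx
  rw [Real.fourierInv_eq'] at hx
  have hx' := congrArg Complex.re hx
  rw [reFourierInv]
  have key : ∫ t, Complex.exp (-(Complex.I * ((inner ℝ x t : ℝ) : ℂ))) * fourier f t =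
      ((2 * Real.pi) ^ d : ℝ) • ∫ v, Complex.exp (((2 * Real.pi * inner ℝ v x : ℝ) : ℂ) * Complex.I)
        • 𝓕 f' v := by
    have h := Measure.integral_comp_smul volume (fun t : EuclideanSpace ℝ (Fin d) =>
      Complex.exp (-(Complex.I * ((inner ℝ x t : ℝ) : ℂ))) * fourier f t) (-(2 * Real.pi))
    rw [finrank_euclideanSpace_fin, abs_inv, abs_pow, abs_neg,
      abs_of_pos (by positivity : 0 < 2 * Real.pi)] at h
    rw [eq_comm, inv_smul_eq_iff₀ (by positivity)] at h
    rw [h]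
    congr 1
    refine integral_congr_ae (ae_of_all _ fun v => ?_)
    simp only
    rw [hFe, smul_eq_mul, real_inner_smul_right, real_inner_comm]
    congr 2
    push_cast
    ring
  rw [key, Complex.smul_re, smul_eq_mul, inv_mul_cancel_left₀ (by positivity)]
  exact hx'

end Inversion

/-! ### The Pinsker kernel and its $L^2$ norm -/

section Pinsker

variable {d : ℕ} {β : ℝ}

theorem continuous_pinskerFourier (hβ : 0 < β) :
    Continuous (pinskerFourier (d := d) β) := by
  unfold pinskerFourier
  have : Continuous fun t : EuclideanSpace ℝ (Fin d) => ‖t‖ ^ β :=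
    continuous_norm.rpow_const fun _ => Or.inr hβ.le
  fun_prop

theorem pinskerFourier_nonneg (t : EuclideanSpace ℝ (Fin d)) : 0 ≤ pinskerFourier β t :=
  le_max_right _ _

theorem pinskerFourier_le_one (t : EuclideanSpace ℝ (Fin d)) : pinskerFourier β t ≤ 1 :=
  max_le (by have := Real.rpow_nonneg (norm_nonneg t) β; linarith) zero_le_one

/-- This matches the kernel to the Sobolev weight and gives the bias bound its constant 1. -/
theorem one_sub_pinskerFourier_le (t : EuclideanSpace ℝ (Fin d)) :
    1 - pinskerFourier β t ≤ ‖t‖ ^ β := by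
  have := le_max_left (1 - ‖t‖ ^ β) 0
  unfold pinskerFourier
  linarith

theorem hasCompactSupport_pinskerFourier (hβ : 0 < β) :
    HasCompactSupport (pinskerFourier (d := d) β) := by
  refine HasCompactSupport.intro (isCompact_closedBall 0 1) fun t ht => ?_
  rw [Metric.mem_closedBall, dist_zero_right, not_le] at ht
  exact max_eq_right (by linarith [Real.one_le_rpow ht.le hβ.le])

theorem integrable_pinskerFourier (hβ : 0 < β) :
    Integrable (pinskerFourier (d := d) β) :=
  (continuous_pinskerFourier hβ).integrable_of_hasCompactSupport
    (hasCompactSupport_pinskerFourier hβ)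

theorem continuous_pinskerKernel (hβ : 0 < β) : Continuous (pinskerKernel d β) :=
  -- `pinskerKernel d β` is by definition `reFourierInv` of the complexified `pinskerFourier β`.
  continuous_reFourierInv (integrable_pinskerFourier hβ).ofReal

theorem lintegral_pinskerKernel_sq_le (hβ : 0 < β) :
    ∫⁻ x, ENNReal.ofReal (pinskerKernel d β x ^ 2) ≤
      ENNReal.ofReal (((2 * Real.pi) ^ d)⁻¹ * ∫ t : EuclideanSpace ℝ (Fin d),
        pinskerFourier β t ^ 2) := by
  have hi : Integrable fun t : EuclideanSpace ℝ (Fin d) => (pinskerFourier β t : ℂ) :=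
    (integrable_pinskerFourier hβ).ofReal
  have hb : ∀ t : EuclideanSpace ℝ (Fin d), ‖(pinskerFourier β t : ℂ)‖ ≤ 1 := fun t => by
    rw [Complex.norm_real, Real.norm_of_nonneg (pinskerFourier_nonneg t)]
    exact pinskerFourier_le_one t
  have h2 := memLp_two_of_integrable_of_bound hi hb
  have hpi := Real.pi_pos
  refine (lintegral_reFourierInv_sq_le hi h2).trans_eq ?_
  rw [ENNReal.ofReal_mul (by positivity)]
  congr 1
  rw [ofReal_integral_eq_lintegral_ofReal]
  · refine lintegral_congr fun t => ?_
    rw [← ofReal_norm, Complex.norm_real,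
      ← ENNReal.ofReal_pow (norm_nonneg _), Real.norm_eq_abs, sq_abs]
  · have := (memLp_two_iff_integrable_sq_norm hi.1).1 h2
    simpa only [Complex.norm_real, Real.norm_eq_abs, sq_abs] using this
  · exact ae_of_all _ fun t => sq_nonneg _

theorem memLp_pinskerKernel (hβ : 0 < β) : MemLp (pinskerKernel d β) 2 := by
  have hc := (continuous_pinskerKernel (d := d) hβ).aestronglyMeasurable (μ := volume)
  refine ⟨hc, ?_⟩
  have h : eLpNorm (pinskerKernel d β) 2 volume ^ 2 < ∞ := by
    rw [eLpNorm_two_sq]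
    refine lt_of_le_of_lt (le_of_eq ?_) ((lintegral_pinskerKernel_sq_le (d := d) hβ).trans_lt
      ENNReal.ofReal_lt_top)
    refine lintegral_congr fun t => ?_
    rw [← ofReal_norm, ← ENNReal.ofReal_pow (norm_nonneg _), Real.norm_eq_abs, sq_abs]
  by_contra hn
  rw [not_lt, top_le_iff] at hn
  simp [hn] at h

/-- Polar coordinates reduce this to $\int_0^1 r^{d-1}(1-r^\beta)^2dr$, and $d$ times the volume of
the unit ball is $S_d$. -/
theorem integral_pinskerFourier_sq (hd : 1 ≤ d) (hβ : 0 < β) :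
    ∫ t : EuclideanSpace ℝ (Fin d), pinskerFourier β t ^ 2 =
      sphereArea d * (2 * β ^ 2 / (d * (β + d) * (2 * β + d))) := by
  have hd0 : (0 : ℝ) < d := by exact_mod_cast hd
  have : Nonempty (Fin d) := ⟨⟨0, hd⟩⟩
  have : Nontrivial (EuclideanSpace ℝ (Fin d)) := by
    apply Module.nontrivial_of_finrank_pos (R := ℝ)
    rw [finrank_euclideanSpace_fin]; exact hd
  have h := integral_fun_norm_addHaar (volume : Measure (EuclideanSpace ℝ (Fin d)))
    (fun r : ℝ => (max (1 - r ^ β) 0) ^ 2)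
  unfold pinskerFourier
  rw [h, finrank_euclideanSpace_fin]
  have hrad : ∫ y in Set.Ioi (0 : ℝ), y ^ (d - 1) • (max (1 - y ^ β) 0) ^ 2 =
      2 * β ^ 2 / (d * (β + d) * (2 * β + d)) := by
    rw [setIntegral_eq_of_subset_of_forall_sdiff_eq_zero (s := Set.Ioc 0 1) measurableSet_Ioi
      Set.Ioc_subset_Ioi_self]
    · rw [← intervalIntegral.integral_of_le zero_le_one]
      have e : ∀ y ∈ Set.uIcc (0 : ℝ) 1, y ^ (d - 1) • (max (1 - y ^ β) 0) ^ 2 =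
          y ^ ((d : ℝ) - 1) - 2 * y ^ (β + d - 1) + y ^ (2 * β + d - 1) := by
        intro y hy
        rw [Set.uIcc_of_le zero_le_one] at hy
        rw [max_eq_left (by linarith [Real.rpow_le_one hy.1 hy.2 hβ.le]), smul_eq_mul]
        have e0 : y ^ (d - 1) = y ^ ((d : ℝ) - 1) := by
          rw [← Real.rpow_natCast, Nat.cast_sub hd, Nat.cast_one]
        have hd1 : (0 : ℝ) ≤ d - 1 := by
          have : (1 : ℝ) ≤ d := by exact_mod_cast hd
          linarith
        have e1 : y ^ (β + d - 1) = y ^ β * y ^ ((d : ℝ) - 1) := by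
          rw [← Real.rpow_add_of_nonneg hy.1 hβ.le hd1]; congr 1; ring
        have e2 : y ^ (2 * β + d - 1) = y ^ β * y ^ β * y ^ ((d : ℝ) - 1) := by
          rw [← Real.rpow_add_of_nonneg hy.1 hβ.le hβ.le,
            ← Real.rpow_add_of_nonneg hy.1 (by linarith) hd1]
          congr 1; ring
        rw [e0, e1, e2]; ring
      rw [intervalIntegral.integral_congr e]
      have i1 : IntervalIntegrable (fun y : ℝ => y ^ ((d : ℝ) - 1)) volume 0 1 :=
        intervalIntegral.intervalIntegrable_rpow' (by linarith)
      have i2 : IntervalIntegrable (fun y : ℝ => 2 * y ^ (β + d - 1)) volume 0 1 :=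
        (intervalIntegral.intervalIntegrable_rpow' (by linarith)).const_mul 2
      have i3 : IntervalIntegrable (fun y : ℝ => y ^ (2 * β + d - 1)) volume 0 1 :=
        intervalIntegral.intervalIntegrable_rpow' (by linarith)
      rw [intervalIntegral.integral_add (i1.sub i2) i3, intervalIntegral.integral_sub i1 i2,
        intervalIntegral.integral_const_mul, integral_rpow (Or.inl (by linarith)),
        integral_rpow (Or.inl (by linarith)), integral_rpow (Or.inl (by linarith))]
      simp only [Real.one_rpow, sub_add_cancel]
      rw [Real.zero_rpow hd0.ne', Real.zero_rpow (by positivity), Real.zero_rpow (by positivity)]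
      field_simp
      ring
    · intro y hy
      have hy1 : 1 < y := by
        by_contra hc
        exact hy.2 ⟨hy.1, not_lt.1 hc⟩
      rw [max_eq_right (by linarith [Real.one_le_rpow hy1.le hβ.le])]
      simp
  rw [hrad, nsmul_eq_mul, smul_eq_mul, ← mul_assoc]
  congr 1
  rw [Measure.real, EuclideanSpace.volume_ball, Fintype.card_fin, ENNReal.ofReal_one, one_pow,
    one_mul, sphereArea, ENNReal.toReal_ofReal, Real.Gamma_add_one (by positivity),
    Real.sqrt_eq_rpow, ← Real.rpow_natCast, ← Real.rpow_mul Real.pi_pos.le]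
  · rw [show (1 / 2 * (d : ℝ)) = d / 2 by ring]
    have := Real.Gamma_pos_of_pos (show 0 < (d : ℝ) / 2 by positivity)
    field_simp
  · have := Real.Gamma_pos_of_pos (show 0 < (d : ℝ) / 2 + 1 by positivity)
    have := Real.pi_pos
    positivity

end Pinsker

/-! ### Boundedness of the class and bias of the kernel estimator -/

section SobolevClass

variable {d : ℕ} {β Q : ℝ} {p : EuclideanSpace ℝ (Fin d) → ℝ}

theorem integrable_of_mem_sobolevClass (hp : p ∈ sobolevClass d β Q) : Integrable p := by
  by_contra h
  have := hp.2.1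
  rw [integral_undef h] at this
  exact zero_ne_one this

theorem norm_fourier_le_one (hp : p ∈ sobolevClass d β Q) (t : EuclideanSpace ℝ (Fin d)) :
    ‖fourier p t‖ ≤ 1 := by
  refine (norm_fourier_le t).trans_eq ?_
  rw [← hp.2.1]
  exact integral_congr_ae (ae_of_all _ fun x => Real.norm_of_nonneg (hp.1 x))

theorem integrable_sobolev_weight (hp : p ∈ sobolevClass d β Q) (hβ : 0 < β) :
    Integrable fun t => ‖t‖ ^ (2 * β) * ‖fourier p t‖ ^ 2 := by
  have hc := continuous_fourier (integrable_of_mem_sobolevClass hp)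
  have hc' : Continuous fun t : EuclideanSpace ℝ (Fin d) => ‖t‖ ^ (2 * β) :=
    continuous_norm.rpow_const fun _ => Or.inr (by positivity)
  refine ⟨(by fun_prop : Continuous _).aestronglyMeasurable, ?_⟩
  rw [hasFiniteIntegral_iff_ofReal (ae_of_all _ fun t => by positivity)]
  exact hp.2.2.trans_lt ENNReal.ofReal_lt_top

/-- For $r\le1$ the first term alone is at least 1. For $r\ge1$, put $s=r^{2\beta}$: then $a\le
s^{-1}+sa^2$, and $1+r\le2r$ bounds $s^{-1}$ by the first term. -/
theorem norm_le_add_weight {r a β : ℝ} (hr : 0 ≤ r) (ha1 : a ≤ 1) (hβ : 0 < β) :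
    a ≤ (4 : ℝ) ^ β * (1 + r) ^ (-(2 * β)) + r ^ (2 * β) * a ^ 2 := by
  have h4 : (4 : ℝ) ^ β = 2 ^ (2 * β) := by
    rw [Real.rpow_mul (by norm_num)]; norm_num
  rcases le_total r 1 with h | h
  · have : 1 ≤ (4 : ℝ) ^ β * (1 + r) ^ (-(2 * β)) := by
      rw [Real.rpow_neg (by positivity), h4, ← div_eq_mul_inv,
        one_le_div (by positivity)]
      exact Real.rpow_le_rpow (by positivity) (by linarith) (by positivity)
    have : 0 ≤ r ^ (2 * β) * a ^ 2 := by positivity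
    linarith
  · have hw : r ^ (-(2 * β)) ≤ (4 : ℝ) ^ β * (1 + r) ^ (-(2 * β)) := by
      rw [Real.rpow_neg (by positivity), Real.rpow_neg (by positivity), h4, ← div_eq_mul_inv,
        ← one_div, div_le_div_iff₀ (by positivity) (by positivity), one_mul,
        ← Real.mul_rpow (by positivity) (by positivity)]
      exact Real.rpow_le_rpow (by positivity) (by linarith) (by positivity)
    refine le_trans ?_ (add_le_add_left hw _)
    have hpos : 0 < r ^ (2 * β) := by positivity
    rw [Real.rpow_neg (by positivity)]
    set s := r ^ (2 * β)
    have : s⁻¹ + s * a ^ 2 - a = s⁻¹ * ((s * a - 1 / 2) ^ 2 + 3 / 4) := by field_simp; ring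
    have h0 : 0 ≤ s⁻¹ * ((s * a - 1 / 2) ^ 2 + 3 / 4) := by positivity
    linarith

/-- The condition $2\beta>d$ is exactly what integrability at infinity requires; the full strength
of $\beta>d/2$ enters through this lemma. -/
theorem integrable_japanese_weight (hβ : (d : ℝ) / 2 < β) :
    Integrable fun t : EuclideanSpace ℝ (Fin d) => (4 : ℝ) ^ β * (1 + ‖t‖) ^ (-(2 * β)) := by
  refine (integrable_one_add_norm ?_).const_mul _
  rw [finrank_euclideanSpace_fin]
  linarith

theorem integrable_fourier (hp : p ∈ sobolevClass d β Q) (hβ : (d : ℝ) / 2 < β) :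
    Integrable (fourier p) := by
  have hβ0 : 0 < β := lt_of_le_of_lt (by positivity) hβ
  refine ((integrable_japanese_weight hβ).add (integrable_sobolev_weight hp hβ0)).mono'
    (continuous_fourier (integrable_of_mem_sobolevClass hp)).aestronglyMeasurable
    (ae_of_all _ fun t => ?_)
  exact norm_le_add_weight (norm_nonneg _) (norm_fourier_le_one hp t) hβ0

/-- A bound for the densities in the Sobolev class. -/
def sobolevSupBound (d : ℕ) (β Q : ℝ) : ℝ :=
  ((2 * Real.pi) ^ d)⁻¹ *
    ((∫ t : EuclideanSpace ℝ (Fin d), (4 : ℝ) ^ β * (1 + ‖t‖) ^ (-(2 * β))) + Q)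

theorem integral_sobolev_weight_le (hp : p ∈ sobolevClass d β Q) (hQ : 0 < Q) :
    ∫ t, ‖t‖ ^ (2 * β) * ‖fourier p t‖ ^ 2 ≤ Q := by
  refine (ENNReal.ofReal_le_ofReal_iff hQ.le).1 ((?_ : _ ≤ _).trans hp.2.2)
  by_cases h : Integrable fun t => ‖t‖ ^ (2 * β) * ‖fourier p t‖ ^ 2
  · rw [ofReal_integral_eq_lintegral_ofReal h (ae_of_all _ fun t => by positivity)]
  · rw [integral_undef h]; simp

theorem abs_reFourierInv_fourier_le (hp : p ∈ sobolevClass d β Q) (hβ : (d : ℝ) / 2 < β)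
    (hQ : 0 < Q) (x : EuclideanSpace ℝ (Fin d)) :
    |reFourierInv (fourier p) x| ≤ sobolevSupBound d β Q := by
  have hβ0 : 0 < β := lt_of_le_of_lt (by positivity) hβ
  have hpi := Real.pi_pos
  refine (abs_reFourierInv_le _ x).trans ?_
  unfold sobolevSupBound
  gcongr
  calc ∫ t, ‖fourier p t‖
      ≤ ∫ t, ((4 : ℝ) ^ β * (1 + ‖t‖) ^ (-(2 * β)) + ‖t‖ ^ (2 * β) * ‖fourier p t‖ ^ 2) :=
        integral_mono (integrable_fourier hp hβ).norm
          ((integrable_japanese_weight hβ).add (integrable_sobolev_weight hp hβ0)) fun t =>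
          norm_le_add_weight (norm_nonneg _) (norm_fourier_le_one hp t) hβ0
    _ ≤ _ := by
        rw [integral_add (integrable_japanese_weight hβ) (integrable_sobolev_weight hp hβ0)]
        gcongr
        exact integral_sobolev_weight_le hp hQ

/-- The mean of the kernel estimator is a convolution, so on the Fourier side it multiplies by
$(1-\|hs\|^\beta)_+$. The proof is Fubini. -/
theorem integral_scaled_pinskerKernel_mul (hβ : 0 < β) (hp : Integrable p) {h : ℝ} (hh : 0 < h)
    (x : EuclideanSpace ℝ (Fin d)) :
    ∫ y, (h ^ d)⁻¹ * pinskerKernel d β (h⁻¹ • (y - x)) * p y =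
      reFourierInv (fun s => (pinskerFourier β (h • s) : ℂ) * fourier p s) x := by
  set k : EuclideanSpace ℝ (Fin d) → ℝ := fun s => pinskerFourier β (h • s) with hk
  have hki : Integrable k := (integrable_pinskerFourier hβ).comp_smul hh.ne'
  have hK : ∀ y, (h ^ d)⁻¹ * pinskerKernel d β (h⁻¹ • (y - x)) =
      ((2 * Real.pi) ^ d)⁻¹ *
        (∫ s, Complex.exp (-(Complex.I * ((inner ℝ (y - x) s : ℝ) : ℂ))) * (k s : ℂ)).re := by
    intro y
    have e := Measure.integral_comp_smul volume (fun t : EuclideanSpace ℝ (Fin d) =>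
      Complex.exp (-(Complex.I * ((inner ℝ (h⁻¹ • (y - x)) t : ℝ) : ℂ))) *
        (pinskerFourier β t : ℂ)) h
    rw [finrank_euclideanSpace_fin, abs_of_pos (by positivity)] at e
    have e' : ∫ s, Complex.exp (-(Complex.I * ((inner ℝ (y - x) s : ℝ) : ℂ))) * (k s : ℂ) =
        ∫ s, Complex.exp (-(Complex.I * ((inner ℝ (h⁻¹ • (y - x)) (h • s) : ℝ) : ℂ))) *
          (pinskerFourier β (h • s) : ℂ) := by
      congr 1; ext s
      rw [real_inner_smul_left, real_inner_smul_right, inv_mul_cancel_left₀ hh.ne']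
    rw [e', e, Complex.smul_re, pinskerKernel, smul_eq_mul]
    ring
  have hint : Integrable (fun z : EuclideanSpace ℝ (Fin d) × EuclideanSpace ℝ (Fin d) =>
      Complex.exp (-(Complex.I * ((inner ℝ (z.1 - x) z.2 : ℝ) : ℂ))) * ((p z.1 : ℂ) * (k z.2 : ℂ)))
      (volume.prod volume) := by
    refine (hp.ofReal.mul_prod hki.ofReal).bdd_mul (c := 1) (by fun_prop)
      (ae_of_all _ fun t => (norm_exp_neg_I_mul _).le)
  have step : ∫ y, (h ^ d)⁻¹ * pinskerKernel d β (h⁻¹ • (y - x)) * p y =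
      ((2 * Real.pi) ^ d)⁻¹ * (∫ y, ∫ s,
        Complex.exp (-(Complex.I * ((inner ℝ (y - x) s : ℝ) : ℂ))) * ((p y : ℂ) * (k s : ℂ))).re := by
    have hre := integral_re (𝕜 := ℂ) hint.integral_prod_left
    simp only [RCLike.re_eq_complex_re] at hre
    rw [← hre, ← integral_const_mul]
    congr 1; ext y
    rw [hK]
    have : ∫ s, Complex.exp (-(Complex.I * ((inner ℝ (y - x) s : ℝ) : ℂ))) *
        ((p y : ℂ) * (k s : ℂ)) = (p y : ℂ) *
        ∫ s, Complex.exp (-(Complex.I * ((inner ℝ (y - x) s : ℝ) : ℂ))) * (k s : ℂ) := by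
      rw [← integral_const_mul]
      congr 1; ext s; ring
    rw [this, Complex.re_ofReal_mul]
    ring
  rw [step, integral_integral_swap hint, reFourierInv]
  congr 2
  -- The substitution $s\mapsto-s$, harmless because the multiplier is even, restores the sign used
  -- in `fourier`.
  rw [← integral_neg_eq_self]
  congr 1; ext s
  have : ∀ y, Complex.exp (-(Complex.I * ((inner ℝ (y - x) (-s) : ℝ) : ℂ))) *
      ((p y : ℂ) * (k (-s) : ℂ)) =
      (Complex.exp (-(Complex.I * ((inner ℝ x s : ℝ) : ℂ))) * (k s : ℂ)) *
        (Complex.exp (Complex.I * ((inner ℝ y s : ℝ) : ℂ)) * (p y : ℂ)) := by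
    intro y
    have : k (-s) = k s := by simp [hk, pinskerFourier]
    rw [this, inner_neg_right, inner_sub_left]
    have e : -(Complex.I * ((-(inner ℝ y s - inner ℝ x s) : ℝ) : ℂ)) =
      -(Complex.I * ((inner ℝ x s : ℝ) : ℂ)) + Complex.I * ((inner ℝ y s : ℝ) : ℂ) := by
      push_cast; ring
    rw [e, Complex.exp_add]
    ring
  simp only [this]
  rw [integral_const_mul, ← fourier]
  ring

/-- The bias has multiplier $(1-\|hs\|^\beta)_+-1$, of modulus at most $(h\|s\|)^\beta$. Plancherel
extracts $h^{2\beta}$ and leaves the Sobolev integral. -/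
theorem lintegral_bias_sq_le (hp : p ∈ sobolevClass d β Q) (hβ : (d : ℝ) / 2 < β)
    {h : ℝ} (hh : 0 < h) :
    ∫⁻ x, ENNReal.ofReal (((∫ y, (h ^ d)⁻¹ * pinskerKernel d β (h⁻¹ • (y - x)) * p y) -
      reFourierInv (fourier p) x) ^ 2) ≤
      ENNReal.ofReal (((2 * Real.pi) ^ d)⁻¹ * (Q * h ^ (2 * β))) := by
  have hβ0 : 0 < β := lt_of_le_of_lt (by positivity) hβ
  have hpi := Real.pi_pos
  have hF := integrable_fourier hp hβ
  have hcF := continuous_fourier (integrable_of_mem_sobolevClass hp)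
  have hcκ := continuous_pinskerFourier (d := d) hβ0
  set g : EuclideanSpace ℝ (Fin d) → ℂ := fun s =>
    (pinskerFourier β (h • s) : ℂ) * fourier p s - fourier p s with hg
  have hgn : ∀ s, ‖g s‖ = (1 - pinskerFourier β (h • s)) * ‖fourier p s‖ := by
    intro s
    have : g s = -(((1 - pinskerFourier β (h • s) : ℝ) : ℂ) * fourier p s) := by
      simp only [hg]; push_cast; ring
    rw [this, norm_neg, norm_mul, Complex.norm_real, Real.norm_of_nonneg
      (by linarith [pinskerFourier_le_one (β := β) (h • s)])]
  have hi1 : Integrable fun s => (pinskerFourier β (h • s) : ℂ) * fourier p s := by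
    refine hF.bdd_mul (c := 1) (by fun_prop) (ae_of_all _ fun s => ?_)
    rw [Complex.norm_real, Real.norm_of_nonneg (pinskerFourier_nonneg _)]
    exact pinskerFourier_le_one _
  have hgi : Integrable g := hi1.sub hF
  have hgb : ∀ s, ‖g s‖ ≤ 1 := fun s => by
    rw [hgn]
    exact mul_le_one₀ (by linarith [pinskerFourier_nonneg (β := β) (h • s)]) (norm_nonneg _)
      (norm_fourier_le_one hp s)
  simp only [integral_scaled_pinskerKernel_mul hβ0 (integrable_of_mem_sobolevClass hp) hh,
    ← reFourierInv_sub hi1 hF]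
  refine (lintegral_reFourierInv_sq_le hgi (memLp_two_of_integrable_of_bound hgi hgb)).trans ?_
  rw [ENNReal.ofReal_mul (by positivity)]
  gcongr
  calc ∫⁻ t, ‖g t‖ₑ ^ 2
      ≤ ∫⁻ t, ENNReal.ofReal (h ^ (2 * β)) *
          ENNReal.ofReal (‖t‖ ^ (2 * β) * ‖fourier p t‖ ^ 2) := by
        refine lintegral_mono fun t => ?_
        rw [← ofReal_norm, ← ENNReal.ofReal_pow (norm_nonneg _),
          ← ENNReal.ofReal_mul (by positivity), hgn]
        refine ENNReal.ofReal_le_ofReal ?_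
        rw [mul_pow, ← mul_assoc, ← Real.mul_rpow hh.le (norm_nonneg _), mul_comm 2 β,
          Real.rpow_mul (by positivity), Real.rpow_two]
        have h1 := one_sub_pinskerFourier_le (β := β) (h • t)
        rw [norm_smul, Real.norm_of_nonneg hh.le] at h1
        have h0 := pinskerFourier_le_one (β := β) (h • t)
        gcongr
    _ ≤ ENNReal.ofReal (h ^ (2 * β)) * ENNReal.ofReal Q := by
        rw [lintegral_const_mul' _ _ ENNReal.ofReal_ne_top]
        gcongr
        exact hp.2.2
    _ = _ := by rw [← ENNReal.ofReal_mul (by positivity), mul_comm]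

end SobolevClass

/-! ### Mean squared error of a sample mean -/

section SampleMean

open ProbabilityTheory

variable {α : Type*} [MeasurableSpace α] {μ : Measure α} [IsProbabilityMeasure μ]

/-- Bias-variance decomposition, with the variance bounded by the second moment. It serves twice:
for kernel estimators at a point, with $c=q(x)$, and for empirical coefficients, with $c$ their
mean. -/
theorem lintegral_sampleMean_sub_sq_le {m : ℕ} (hm : 0 < m) {g : α → ℝ} (hg : MemLp g 2 μ)
    (c : ℝ) :
    ∫⁻ Y : Fin m → α, ENNReal.ofReal (((1 / (m : ℝ)) * ∑ i, g (Y i) - c) ^ 2)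
        ∂(Measure.pi fun _ => μ) ≤
      ENNReal.ofReal (((∫ y, g y ∂μ) - c) ^ 2) +
        ENNReal.ofReal (1 / (m : ℝ)) * ∫⁻ y, ENNReal.ofReal (g y ^ 2) ∂μ := by
  have hm0 : (0 : ℝ) < m := by exact_mod_cast hm
  set P : Measure (Fin m → α) := Measure.pi fun _ => μ with hP
  have hgi : ∀ i : Fin m, MemLp (fun Y : Fin m → α => g (Y i)) 2 P := fun i =>
    hg.comp_measurePreserving (measurePreserving_eval (fun _ => μ) i)
  have hsum : MemLp (fun Y : Fin m → α => ∑ i, g (Y i)) 2 P :=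
    memLp_finsetSum _ fun i _ => hgi i
  have hmean : MemLp (fun Y : Fin m → α => (1 / (m : ℝ)) * ∑ i, g (Y i)) 2 P :=
    hsum.const_mul _
  set W : (Fin m → α) → ℝ := fun Y => (1 / (m : ℝ)) * ∑ i, g (Y i) - c with hW
  have hWL : MemLp W 2 P := hmean.sub (memLp_const c)
  have hEW : ∫ Y, W Y ∂P = (∫ y, g y ∂μ) - c := by
    rw [hW, integral_sub (hmean.integrable (by norm_num)) (integrable_const c),
      integral_const_mul, integral_finsetSum _ fun i _ => (hgi i).integrable (by norm_num)]
    have : ∀ i : Fin m, ∫ Y, g (Y i) ∂P = ∫ y, g y ∂μ := fun i =>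
      integral_comp_eval (μ := fun _ : Fin m => μ) (i := i) hg.1
    simp only [this]
    simp
    field_simp
  have hVar : Var[W; P] ≤ 1 / (m : ℝ) * ∫ y, g y ^ 2 ∂μ := by
    have e1 : Var[W; P] = (1 / (m : ℝ)) ^ 2 * (m * Var[g; μ]) := by
      rw [hW, variance_sub_const hmean.1, variance_const_mul]
      congr 1
      have := variance_sum_pi (μ := fun _ : Fin m => μ) (X := fun _ => g) fun _ => hg
      rw [Finset.sum_const, Finset.card_univ, Fintype.card_fin, nsmul_eq_mul] at this
      rw [← this]
      congr 1; ext Y; simp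
    have e2 := variance_le_expectation_sq (μ := μ) hg.1
    simp only [Pi.pow_apply] at e2
    rw [e1]
    calc (1 / (m : ℝ)) ^ 2 * (m * Var[g; μ]) = 1 / (m : ℝ) * Var[g; μ] := by field_simp
      _ ≤ _ := by gcongr
  have hW2 : ∫ Y, W Y ^ 2 ∂P = Var[W; P] + ((∫ y, g y ∂μ) - c) ^ 2 := by
    have := variance_eq_sub hWL
    rw [hEW] at this
    simp only [Pi.pow_apply] at this
    linarith
  rw [← ofReal_integral_eq_lintegral_ofReal hWL.integrable_sq (ae_of_all _ fun Y => sq_nonneg _),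
    ← ofReal_integral_eq_lintegral_ofReal hg.integrable_sq (ae_of_all _ fun Y => sq_nonneg _),
    ← ENNReal.ofReal_mul (by positivity), ← ENNReal.ofReal_add (by positivity)
      (mul_nonneg (by positivity) (integral_nonneg fun y => sq_nonneg _)), hW2]
  exact ENNReal.ofReal_le_ofReal (by linarith)

end SampleMean

/-! ### The law of one observation -/

section Law

variable {d : ℕ} {β Q : ℝ} {p q : EuclideanSpace ℝ (Fin d) → ℝ}

theorem isProbabilityMeasure_law (hp : p ∈ sobolevClass d β Q) :
    IsProbabilityMeasure (law p) := by
  refine ⟨?_⟩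
  rw [law, withDensity_apply _ MeasurableSet.univ, Measure.restrict_univ,
    ← ofReal_integral_eq_lintegral_ofReal (integrable_of_mem_sobolevClass hp) (ae_of_all _ hp.1),
    hp.2.1, ENNReal.ofReal_one]

theorem integral_law (hp : p ∈ sobolevClass d β Q) (f : EuclideanSpace ℝ (Fin d) → ℝ) :
    ∫ x, f x ∂(law p) = ∫ x, f x * p x := by
  rw [law, integral_withDensity_eq_integral_toReal_smul₀
    (integrable_of_mem_sobolevClass hp).1.aemeasurable.ennreal_ofReal
    (ae_of_all _ fun x => ENNReal.ofReal_lt_top)]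
  refine integral_congr_ae (ae_of_all _ fun x => ?_)
  simp only
  rw [ENNReal.toReal_ofReal (hp.1 x), smul_eq_mul, mul_comm]

/-- Domination by a multiple of Lebesgue measure turns $L^2(\mathbb R^d)$ norms into second moments
under $p$. -/
theorem law_le (hp : p ∈ sobolevClass d β Q) (hβ : (d : ℝ) / 2 < β) (hQ : 0 < Q) :
    law p ≤ ENNReal.ofReal (sobolevSupBound d β Q) • volume := by
  have h := ae_eq_reFourierInv_fourier (integrable_of_mem_sobolevClass hp)
    (integrable_fourier hp hβ)
  rw [← withDensity_const]
  refine withDensity_mono (h.mono fun x hx => ?_)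
  simp only [hx]
  exact ENNReal.ofReal_le_ofReal
    ((le_abs_self _).trans (abs_reFourierInv_fourier_le hp hβ hQ x))

end Law

/-! ### Risk of one Pinsker kernel estimator -/

section MeanIntegratedSquaredError

variable {d : ℕ} {β Q : ℝ} {p : EuclideanSpace ℝ (Fin d) → ℝ}

theorem continuous_kernelEstimator {m : ℕ} {K : EuclideanSpace ℝ (Fin d) → ℝ} (hK : Continuous K)
    (h : ℝ) :
    Continuous fun z : (Fin m → EuclideanSpace ℝ (Fin d)) × EuclideanSpace ℝ (Fin d) =>
      kernelEstimator K h z.1 z.2 := by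
  unfold kernelEstimator
  fun_prop

theorem lintegral_scaled_pinskerKernel_sq_le (hβ : 0 < β) {h : ℝ} (hh : 0 < h)
    (y : EuclideanSpace ℝ (Fin d)) :
    ∫⁻ x, ENNReal.ofReal (((h ^ d)⁻¹ * pinskerKernel d β (h⁻¹ • (y - x))) ^ 2) ≤
      ENNReal.ofReal (((2 * Real.pi) ^ d)⁻¹ * ((h ^ d)⁻¹ *
        ∫ t : EuclideanSpace ℝ (Fin d), pinskerFourier β t ^ 2)) := by
  simp only [mul_pow, ENNReal.ofReal_mul (sq_nonneg (h ^ d)⁻¹)]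
  rw [lintegral_const_mul' _ _ ENNReal.ofReal_ne_top,
    lintegral_sub_left_eq_self (fun x => ENNReal.ofReal (pinskerKernel d β (h⁻¹ • x) ^ 2)),
    lintegral_comp_smul (inv_ne_zero hh.ne')
      (fun x => ENNReal.ofReal (pinskerKernel d β x ^ 2)), finrank_euclideanSpace_fin,
    ← mul_assoc, ← ENNReal.ofReal_mul (by positivity), inv_pow, inv_pow, inv_inv,
    abs_of_pos (by positivity)]
  refine (mul_le_mul_right (lintegral_pinskerKernel_sq_le hβ) _).trans_eq ?_
  rw [← ENNReal.ofReal_mul (by positivity)]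
  congr 1
  field_simp
  ring

/-- The bound for the mean integrated squared error of the Pinsker kernel estimator. -/
theorem lintegral_kernelEstimator_sub_sq_le (hp : p ∈ sobolevClass d β Q)
    (hβ : (d : ℝ) / 2 < β) {m : ℕ} (hm : 0 < m) {h : ℝ} (hh : 0 < h) :
    ∫⁻ Y : Fin m → EuclideanSpace ℝ (Fin d), ∫⁻ x,
        ENNReal.ofReal ((kernelEstimator (pinskerKernel d β) h Y x -
          reFourierInv (fourier p) x) ^ 2) ∂volume ∂(Measure.pi fun _ => law p) ≤
      ENNReal.ofReal (((2 * Real.pi) ^ d)⁻¹ * (Q * h ^ (2 * β))) +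
        ENNReal.ofReal (1 / (m : ℝ)) * ENNReal.ofReal (((2 * Real.pi) ^ d)⁻¹ * ((h ^ d)⁻¹ *
        ∫ t : EuclideanSpace ℝ (Fin d), pinskerFourier β t ^ 2)) := by
  have hβ0 : 0 < β := lt_of_le_of_lt (by positivity) hβ
  have := isProbabilityMeasure_law hp
  have hcK := continuous_pinskerKernel (d := d) hβ0
  have hcq := continuous_reFourierInv (integrable_fourier hp hβ)
  have hcE := continuous_kernelEstimator (m := m) hcK h
  have hKb : ∀ x, |pinskerKernel d β x| ≤ _ := abs_reFourierInv_le _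
  have hkm : Measurable fun z : EuclideanSpace ℝ (Fin d) × EuclideanSpace ℝ (Fin d) =>
      ENNReal.ofReal (((h ^ d)⁻¹ * pinskerKernel d β (h⁻¹ • (z.2 - z.1))) ^ 2) :=
    ((by fun_prop : Continuous fun z : EuclideanSpace ℝ (Fin d) × EuclideanSpace ℝ (Fin d) =>
      ((h ^ d)⁻¹ * pinskerKernel d β (h⁻¹ • (z.2 - z.1))) ^ 2).measurable).ennreal_ofReal
  -- With $x$ outside, the estimator at fixed $x$ is a sample mean of scaled kernels.
  rw [lintegral_lintegral_swap
    ((by fun_prop : Continuous fun z : (Fin m → EuclideanSpace ℝ (Fin d)) ×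
      EuclideanSpace ℝ (Fin d) => (kernelEstimator (pinskerKernel d β) h z.1 z.2 -
        reFourierInv (fourier p) z.2) ^ 2).measurable.ennreal_ofReal.aemeasurable)]
  calc _ ≤ ∫⁻ x, (ENNReal.ofReal (((∫ y, (h ^ d)⁻¹ * pinskerKernel d β (h⁻¹ • (y - x)) * p y) -
          reFourierInv (fourier p) x) ^ 2) + ENNReal.ofReal (1 / (m : ℝ)) *
          ∫⁻ y, ENNReal.ofReal (((h ^ d)⁻¹ * pinskerKernel d β (h⁻¹ • (y - x))) ^ 2)
            ∂(law p)) := by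
        refine lintegral_mono fun x => ?_
        have hg : MemLp (fun y => (h ^ d)⁻¹ * pinskerKernel d β (h⁻¹ • (y - x))) 2 (law p) := by
          refine MemLp.of_bound (by fun_prop : Continuous _).aestronglyMeasurable
            ((h ^ d)⁻¹ * (((2 * Real.pi) ^ d)⁻¹ *
              ∫ t : EuclideanSpace ℝ (Fin d), ‖(pinskerFourier β t : ℂ)‖))
            (ae_of_all _ fun y => ?_)
          rw [norm_mul, Real.norm_of_nonneg (by positivity)]
          exact mul_le_mul_of_nonneg_left (hKb _) (by positivity)
        have key := lintegral_sampleMean_sub_sq_le hm hg (reFourierInv (fourier p) x)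
        rw [integral_law hp] at key
        refine le_trans (le_of_eq ?_) key
        refine lintegral_congr fun Y => ?_
        rw [kernelEstimator, ← Finset.mul_sum, ← mul_assoc]
        congr 4
        field_simp
    _ = (∫⁻ x, ENNReal.ofReal (((∫ y, (h ^ d)⁻¹ * pinskerKernel d β (h⁻¹ • (y - x)) * p y) -
          reFourierInv (fourier p) x) ^ 2)) + ENNReal.ofReal (1 / (m : ℝ)) *
          ∫⁻ y, (∫⁻ x, ENNReal.ofReal (((h ^ d)⁻¹ * pinskerKernel d β (h⁻¹ • (y - x))) ^ 2))
            ∂(law p) := by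
        -- In the variance term $x$ is integrated first: the bound for that integral does not depend
        -- on $y$, so $p$ drops out.
        rw [lintegral_add_right _ (hkm.lintegral_prod_right'.const_mul _),
          lintegral_const_mul' _ _ ENNReal.ofReal_ne_top, lintegral_lintegral_swap]
        exact hkm.aemeasurable
    _ ≤ _ := by
        refine add_le_add (lintegral_bias_sq_le hp hβ hh) (mul_le_mul_right ?_ _)
        refine (lintegral_mono fun y => lintegral_scaled_pinskerKernel_sq_le hβ0 hh y).trans ?_
        rw [lintegral_const, measure_univ, mul_one]

end MeanIntegratedSquaredError

/-! ### Deterministic oracle inequality for both kinds of aggregates -/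

section OracleInequality

variable {d M l : ℕ} {f : Fin M → EuclideanSpace ℝ (Fin d) → ℝ}
  {q g : EuclideanSpace ℝ (Fin d) → ℝ} {Y : Fin l → EuclideanSpace ℝ (Fin d)}

theorem combination_add (w v : Fin M → ℝ) (x : EuclideanSpace ℝ (Fin d)) :
    combination f (w + v) x = combination f w x + combination f v x := by
  simp [combination, add_mul, Finset.sum_add_distrib]

theorem combination_smul (c : ℝ) (w : Fin M → ℝ) (x : EuclideanSpace ℝ (Fin d)) :
    combination f (c • w) x = c * combination f w x := by
  simp [combination, Finset.mul_sum, mul_assoc]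

theorem combination_single (k : Fin M) : combination f (Pi.single k 1) = f k := by
  ext x; simp [combination, Pi.single_apply]

theorem combination_sub (w v : Fin M → ℝ) (x : EuclideanSpace ℝ (Fin d)) :
    combination f (w - v) x = combination f w x - combination f v x := by
  simp [combination, sub_mul, Finset.sum_sub_distrib]

theorem memLp_combination (hf : ∀ j, MemLp (f j) 2 volume) (w : Fin M → ℝ) :
    MemLp (combination f w) 2 volume :=
  memLp_finsetSum _ fun j _ => (hf j).const_mul _

theorem exists_combination_eq_of_mem_span {u : EuclideanSpace ℝ (Fin d) → ℝ}
    (hu : u ∈ Submodule.span ℝ (Set.range f)) : ∃ w, u = combination f w := by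
  obtain ⟨w, hw⟩ := (Submodule.mem_span_range_iff_exists_fun ℝ).1 hu
  exact ⟨w, by rw [← hw]; ext x; simp [combination]⟩

/-- The fluctuation of the empirical criterion along the direction `w`. -/
def excess (f : Fin M → EuclideanSpace ℝ (Fin d) → ℝ) (q : EuclideanSpace ℝ (Fin d) → ℝ)
    (Y : Fin l → EuclideanSpace ℝ (Fin d)) (w : Fin M → ℝ) : ℝ :=
  2 * ((1 / (l : ℝ)) * ∑ i, combination f w (Y i) - ∫ x, combination f w x * q x) -
    ∫ x, combination f w x ^ 2

/-- With $g=f_k+u$, $\|g-q\|^2=\|f_k-q\|^2+2\langle g,u\rangle-2\langle u,q\rangle-\|u\|^2$, and the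
hypothesis replaces $\langle g,u\rangle$ by an empirical mean. Keeping $-\|u\|^2$ is what makes the
later supremum over $u$ finite. -/
theorem integral_sub_sq_le_of_integral_mul_le (hf : ∀ j, MemLp (f j) 2 volume)
    (hq : MemLp q 2 volume) (k : Fin M) (w : Fin M → ℝ)
    (hw : ∫ x, (f k x + combination f w x) * combination f w x ≤
      (1 / (l : ℝ)) * ∑ i, combination f w (Y i)) :
    ∫ x, (f k x + combination f w x - q x) ^ 2 ≤
      (∫ x, (f k x - q x) ^ 2) + excess f q Y w := by
  have hu := memLp_combination hf w
  set u := combination f w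
  have i1 : Integrable fun x => (f k x - q x) ^ 2 := ((hf k).sub hq).integrable_sq
  have i2 : Integrable fun x => (f k x + u x) * u x := ((hf k).add hu).integrable_mul hu
  have i3 : Integrable fun x => u x * q x := hu.integrable_mul hq
  have i4 : Integrable fun x => u x ^ 2 := hu.integrable_sq
  have e : ∀ x, (f k x + u x - q x) ^ 2 = (f k x - q x) ^ 2 + 2 * ((f k x + u x) * u x) -
      2 * (u x * q x) - u x ^ 2 := fun x => by ring
  simp only [e]
  have i5 : Integrable fun x => (f k x - q x) ^ 2 + 2 * ((f k x + u x) * u x) :=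
    i1.add (i2.const_mul 2)
  have i6 : Integrable fun x => (f k x - q x) ^ 2 + 2 * ((f k x + u x) * u x) - 2 * (u x * q x) :=
    i5.sub (i3.const_mul 2)
  rw [integral_sub i6 i4, integral_sub i5 (i3.const_mul 2),
    integral_add i1 (i2.const_mul 2), integral_const_mul, integral_const_mul]
  simp only [excess]
  linarith

/-- The coefficients of $g$ in the orthonormal basis are empirical means, so $\langle
g,u\rangle=P_\ell u$ for every $u$ in the span. -/
theorem exists_excess_of_isLinearAggregate (hf : ∀ j, MemLp (f j) 2 volume)
    (hq : MemLp q 2 volume) (hg : IsLinearAggregate f Y g) (k : Fin M) :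
    ∃ w, g = (fun x => f k x + combination f w x) ∧
      ∫ x, (g x - q x) ^ 2 ≤ (∫ x, (f k x - q x) ^ 2) + excess f q Y w := by
  obtain ⟨M', φ, hφ, horth, hspan, rfl⟩ := hg
  set c : Fin M' → ℝ := fun j => (1 / (l : ℝ)) * ∑ i, φ j (Y i) with hc
  have hgspan : combination φ c ∈ Submodule.span ℝ (Set.range f) := by
    rw [← hspan]
    refine (Submodule.mem_span_range_iff_exists_fun ℝ).2 ⟨c, ?_⟩
    ext x; simp [combination]
  have hkspan : f k ∈ Submodule.span ℝ (Set.range f) := Submodule.subset_span ⟨k, rfl⟩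
  obtain ⟨w, hw⟩ := exists_combination_eq_of_mem_span (Submodule.sub_mem _ hgspan hkspan)
  have hwx : ∀ x, combination f w x = combination φ c x - f k x := fun x => by rw [← hw]; rfl
  have hgw : combination φ c = fun x => f k x + combination f w x := by
    ext x; rw [hwx]; ring
  refine ⟨w, hgw, ?_⟩
  have hu : combination f w ∈ Submodule.span ℝ (Set.range φ) := by
    rw [hspan, ← hw]; exact Submodule.sub_mem _ hgspan hkspan
  obtain ⟨b, hb⟩ := exists_combination_eq_of_mem_span hu
  have key : ∫ x, combination φ c x * combination φ b x =
      (1 / (l : ℝ)) * ∑ i, combination φ b (Y i) := by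
    have hint : ∀ j k, Integrable fun x => φ j x * φ k x := fun j k =>
      (hφ j).integrable_mul (hφ k)
    have e : ∀ x, combination φ c x * combination φ b x =
        ∑ j, ∑ k, c j * b k * (φ j x * φ k x) := fun x => by
      simp only [combination, Finset.sum_mul_sum]
      refine Finset.sum_congr rfl fun j _ => Finset.sum_congr rfl fun k _ => by ring
    simp only [e]
    rw [integral_finsetSum _ fun j _ => integrable_finsetSum _ fun k _ => (hint j k).const_mul _]
    simp only [integral_finsetSum _ fun k _ => (hint _ k).const_mul _, integral_const_mul, horth]
    simp only [mul_ite, mul_one, mul_zero, Finset.sum_ite_eq, Finset.mem_univ, if_true, hc,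
      combination]
    rw [Finset.sum_comm, Finset.mul_sum]
    refine Finset.sum_congr rfl fun j _ => ?_
    rw [← Finset.mul_sum]
    ring
  have := integral_sub_sq_le_of_integral_mul_le (Y := Y) hf hq k w (by
    have e : ∀ x, f k x + combination f w x = combination φ c x := fun x => by rw [hgw]
    simp only [e]
    rw [hb, key])
  refine le_trans (le_of_eq ?_) this
  congr 1; ext x
  have := congrFun hgw x
  simp only [combination] at this ⊢
  rw [← this]

/-- The vertex $e_k$ is an admissible weight, so the derivative of the criterion from the minimizer
towards $e_k$ is nonnegative; this says $\langle g,u\rangle\le P_\ell u$. -/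
theorem exists_excess_of_isConvexAggregate (hf : ∀ j, MemLp (f j) 2 volume)
    (hq : MemLp q 2 volume) (hg : IsConvexAggregate f Y g) (k : Fin M) :
    ∃ w, g = (fun x => f k x + combination f w x) ∧
      ∫ x, (g x - q x) ^ 2 ≤ (∫ x, (f k x - q x) ^ 2) + excess f q Y w := by
  obtain ⟨v, hv, hmin, rfl⟩ := hg
  set e : Fin M → ℝ := Pi.single k 1 with he
  have hes : e ∈ subSimplex M := by
    refine ⟨fun j => ?_, by simp [he]⟩
    rw [he, Pi.single_apply]; split_ifs <;> norm_num
  set w := v - e with hw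
  have hux : ∀ x, f k x + combination f w x = combination f v x := fun x => by
    rw [hw, combination_sub, he, combination_single]; ring
  refine ⟨w, by ext x; rw [hux], ?_⟩
  have hvL := memLp_combination hf v
  have huL := memLp_combination hf w
  have i1 : Integrable fun x => combination f v x ^ 2 := hvL.integrable_sq
  have i2 : Integrable fun x => combination f v x * combination f w x := hvL.integrable_mul huL
  have i3 : Integrable fun x => combination f w x ^ 2 := huL.integrable_sq
  set D : ℝ := (1 / (l : ℝ)) * ∑ i, combination f w (Y i) -
    ∫ x, combination f v x * combination f w x with hD
  -- On the segment from $v$ (at $t=0$) to $e_k$ (at $t=1$) the criterion is quadratic with slope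
  -- $2D$ at the minimizer.
  have hcrit : ∀ t : ℝ, criterion f Y (v + (-t) • w) =
      criterion f Y v + t * (2 * D) + t ^ 2 * ∫ x, combination f w x ^ 2 := by
    intro t
    simp only [criterion, combination_add, combination_smul, Finset.sum_add_distrib,
      ← Finset.mul_sum]
    have ex : ∀ x, (combination f v x + -t * combination f w x) ^ 2 =
        combination f v x ^ 2 - 2 * t * (combination f v x * combination f w x) +
          t ^ 2 * combination f w x ^ 2 := fun x => by ring
    simp only [ex]
    have i4 : Integrable fun x => combination f v x ^ 2 -
        2 * t * (combination f v x * combination f w x) := i1.sub (i2.const_mul _)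
    rw [integral_add i4 (i3.const_mul _),
      integral_sub i1 (i2.const_mul _), integral_const_mul, integral_const_mul, hD]
    ring
  have hD0 : 0 ≤ D := by
    by_contra hneg
    push Not at hneg
    set B := ∫ x, combination f w x ^ 2 with hB
    have hB0 : 0 ≤ B := integral_nonneg fun x => sq_nonneg _
    have hmem : ∀ t : ℝ, 0 ≤ t → t ≤ 1 → v + (-t) • w ∈ subSimplex M := by
      intro t h0 h1
      have ev : ∀ j, (v + (-t) • w) j = (1 - t) * v j + t * e j := fun j => by
        simp [hw]; ring
      refine ⟨fun j => ?_, ?_⟩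
      · rw [ev]
        have := hv.1 j
        have := hes.1 j
        have : 0 ≤ 1 - t := by linarith
        positivity
      · simp only [ev, Finset.sum_add_distrib, ← Finset.mul_sum]
        nlinarith [hv.2, hes.2]
    have ht : ∀ t : ℝ, 0 ≤ t → t ≤ 1 → 0 ≤ t * (2 * D) + t ^ 2 * B := by
      intro t h0 h1
      have h := hmin (hmem t h0 h1)
      simp only [Set.mem_ofPred_eq, hcrit] at h
      linarith
    -- If $D<0$, this $t$ lies in $(0,1]$ and satisfies $tB\le-D$, even when $B=0$; then $2D+tB\le
    -- D<0$ contradicts minimality.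
    set t := -D / (B - D) with htdef
    have hpos : 0 < B - D := by linarith
    have ht0 : 0 < t := div_pos (by linarith) hpos
    have ht1 : t ≤ 1 := (div_le_one hpos).2 (by linarith)
    have h := ht t ht0.le ht1
    have htB : t * B ≤ -D := by
      have : t * (B - D) = -D := div_mul_cancel₀ _ hpos.ne'
      nlinarith
    have : t * (2 * D + t * B) < 0 := mul_neg_of_pos_of_neg ht0 (by linarith)
    nlinarith
  have := integral_sub_sq_le_of_integral_mul_le (Y := Y) hf hq k w (by
    simp only [hux]; linarith)
  simpa only [hux] using this

theorem exists_excess_of_isAggregate {kind : Kind} (hf : ∀ j, MemLp (f j) 2 volume)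
    (hq : MemLp q 2 volume) (hg : IsAggregate kind f Y g) (k : Fin M) :
    ∃ w, g = (fun x => f k x + combination f w x) ∧
      ∫ x, (g x - q x) ^ 2 ≤ (∫ x, (f k x - q x) ^ 2) + excess f q Y w := by
  cases kind
  · exact exists_excess_of_isLinearAggregate hf hq hg k
  · exact exists_excess_of_isConvexAggregate hf hq hg k

end OracleInequality

/-! ### Expected fluctuation over the linear span -/

section Fluctuation

variable {d M l : ℕ} {f : Fin M → EuclideanSpace ℝ (Fin d) → ℝ}
  {q : EuclideanSpace ℝ (Fin d) → ℝ} {Y : Fin l → EuclideanSpace ℝ (Fin d)}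

/-- The supremum of the positive part of `excess`, over a countable set of directions to keep it
measurable. -/
def fluctuation (f : Fin M → EuclideanSpace ℝ (Fin d) → ℝ) (q : EuclideanSpace ℝ (Fin d) → ℝ)
    (Y : Fin l → EuclideanSpace ℝ (Fin d)) : ℝ≥0∞ :=
  ⨆ w : Fin M → ℚ, ENNReal.ofReal (excess f q Y fun j => (w j : ℝ))

theorem integral_combination_mul (hf : ∀ j, MemLp (f j) 2 volume) (hq : MemLp q 2 volume)
    (w : Fin M → ℝ) :
    ∫ x, combination f w x * q x = ∑ j, w j * ∫ x, f j x * q x := by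
  simp only [combination, Finset.sum_mul, mul_assoc]
  have hi : ∀ j, Integrable fun x => w j * (f j x * q x) := fun j =>
    ((hf j).integrable_mul hq).const_mul _
  rw [integral_finsetSum _ fun j _ => hi j]
  simp only [integral_const_mul]

theorem integral_combination_sq (hf : ∀ j, MemLp (f j) 2 volume) (w : Fin M → ℝ) :
    ∫ x, combination f w x ^ 2 = ∑ j, w j * ∑ k, w k * ∫ x, f k x * f j x := by
  simp only [sq]
  rw [integral_combination_mul hf (memLp_combination hf w)]
  refine Finset.sum_congr rfl fun j _ => ?_
  rw [← integral_combination_mul hf (hf j)]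
  simp only [mul_comm]

theorem continuous_excess (hf : ∀ j, MemLp (f j) 2 volume) (hq : MemLp q 2 volume) :
    Continuous fun w => excess f q Y w := by
  simp only [excess, integral_combination_mul hf hq, integral_combination_sq hf]
  simp only [combination]
  fun_prop

/-- The weights of an aggregate are real, but the excess is a quadratic polynomial in them and
rational vectors are dense. -/
theorem excess_le_fluctuation (hf : ∀ j, MemLp (f j) 2 volume) (hq : MemLp q 2 volume)
    (w : Fin M → ℝ) : ENNReal.ofReal (excess f q Y w) ≤ fluctuation f q Y := by
  have hd : DenseRange fun v : Fin M → ℚ => fun j => (v j : ℝ) :=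
    DenseRange.piMap fun _ => Rat.denseRange_cast
  refine hd.induction_on (p := fun w => ENNReal.ofReal (excess f q Y w) ≤ fluctuation f q Y) w
    (isClosed_le (ENNReal.continuous_ofReal.comp (continuous_excess hf hq)) continuous_const)
    fun v => ?_
  exact le_iSup (fun v : Fin M → ℚ => ENNReal.ofReal (excess f q Y fun j => (v j : ℝ))) v

theorem exists_orthonormal_expansion {H : Type*} [NormedAddCommGroup H] [InnerProductSpace ℝ H]
    (F : Fin M → H) :
    ∃ (r : ℕ) (b : Fin r → H) (c : Fin M → Fin r → ℝ), r ≤ M ∧ Orthonormal ℝ b ∧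
      ∀ j, F j = ∑ k, c j k • b k := by
  have : FiniteDimensional ℝ (Submodule.span ℝ (Set.range F)) :=
    FiniteDimensional.span_of_finite ℝ (Set.finite_range F)
  let b := stdOrthonormalBasis ℝ (Submodule.span ℝ (Set.range F))
  have hmem : ∀ j, F j ∈ Submodule.span ℝ (Set.range F) := fun j => Submodule.subset_span ⟨j, rfl⟩
  refine ⟨_, fun k => (b k : H), fun j k => b.repr ⟨F j, hmem j⟩ k, ?_, ?_, fun j => ?_⟩
  · have := finrank_range_le_card (R := ℝ) F
    rwa [Fintype.card_fin] at this
  · exact b.orthonormal.comp_linearIsometry (Submodule.subtypeₗᵢ _)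
  · have h := congrArg (Submodule.subtype _) (b.sum_repr ⟨F j, hmem j⟩)
    rw [map_sum] at h
    exact h.symm

/-- The estimators may be linearly dependent, so the basis can have fewer than $M$ elements. It
comes from $L^2$ classes, hence equality only a.e. -/
theorem exists_orthonormal_coordinates (hf : ∀ j, MemLp (f j) 2 volume) :
    ∃ (r : ℕ) (e : Fin r → EuclideanSpace ℝ (Fin d) → ℝ) (c : Fin M → Fin r → ℝ), r ≤ M ∧
      (∀ k, MemLp (e k) 2 volume) ∧ (∀ j k, (∫ x, e j x * e k x) = if j = k then 1 else 0) ∧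
      ∀ j, f j =ᵐ[volume] combination e (c j) := by
  obtain ⟨r, b, c, hr, hb, hF⟩ := exists_orthonormal_expansion fun j => (hf j).toLp (f j)
  refine ⟨r, fun k => b k, c, hr, fun k => Lp.memLp _, fun j k => ?_, fun j => ?_⟩
  · rw [← orthonormal_iff_ite.1 hb j k, L2.inner_def]
    refine integral_congr_ae (ae_of_all _ fun x => ?_)
    exact mul_comm _ _
  · have h2 := (hf j).coeFn_toLp
    rw [hF j] at h2
    have h3 := Lp.coeFn_finsetSum Finset.univ fun k => c j k • b k
    have h4 : ∀ᵐ x, ∀ k, (c j k • b k) x = c j k * (b k) x :=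
      ae_all_iff.2 fun k => Lp.coeFn_smul _ _
    filter_upwards [h2, h3, h4] with x hx2 hx3 hx4
    rw [← hx2, hx3, Finset.sum_apply]
    simp only [hx4, combination]

theorem excess_le_of_orthonormal
    {r : ℕ} {e : Fin r → EuclideanSpace ℝ (Fin d) → ℝ} (he : ∀ k, MemLp (e k) 2 volume)
    (horth : ∀ j k, (∫ x, e j x * e k x) = if j = k then 1 else 0) (hq : MemLp q 2 volume)
    (b : Fin r → ℝ) :
    excess e q Y b ≤
      ∑ k, ((1 / (l : ℝ)) * ∑ i, e k (Y i) - ∫ x, e k x * q x) ^ 2 := by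
  rw [excess, integral_combination_mul he hq, integral_combination_sq he]
  simp only [horth, mul_ite, mul_one, mul_zero, Finset.sum_ite_eq', Finset.mem_univ, if_true,
    combination]
  rw [Finset.sum_comm]
  simp only [← Finset.mul_sum]
  rw [Finset.mul_sum, ← Finset.sum_sub_distrib, Finset.mul_sum, ← Finset.sum_sub_distrib]
  refine Finset.sum_le_sum fun k _ => ?_
  -- Coordinatewise this is $2b_k\delta_k-b_k^2\le\delta_k^2$.
  nlinarith [sq_nonneg ((1 / (l : ℝ)) * ∑ i, e k (Y i) - (∫ x, e k x * q x) - b k)]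

theorem combination_eq_combination {r : ℕ} {e : Fin r → EuclideanSpace ℝ (Fin d) → ℝ}
    {c : Fin M → Fin r → ℝ} {x : EuclideanSpace ℝ (Fin d)}
    (h : ∀ j, f j x = combination e (c j) x) (w : Fin M → ℝ) :
    combination f w x = combination e (fun k => ∑ j, w j * c j k) x := by
  simp only [combination] at h ⊢
  simp only [h, Finset.mul_sum, Finset.sum_mul]
  rw [Finset.sum_comm]
  simp only [mul_assoc]

/-- In an orthonormal basis, each squared deviation has mean at most $\ell^{-1}\int e_k^2\,d\mu\le
L/\ell$, and there are at most $M$ of them. -/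
theorem lintegral_fluctuation_le {μ : Measure (EuclideanSpace ℝ (Fin d))} [IsProbabilityMeasure μ]
    {L : ℝ} (hμ : μ ≤ ENNReal.ofReal L • volume)
    (hμq : ∀ g : EuclideanSpace ℝ (Fin d) → ℝ, ∫ x, g x ∂μ = ∫ x, g x * q x)
    (hf : ∀ j, MemLp (f j) 2 volume) (hq : MemLp q 2 volume) (hl : 0 < l) :
    ∫⁻ Y : Fin l → EuclideanSpace ℝ (Fin d), fluctuation f q Y ∂(Measure.pi fun _ => μ) ≤
      M * (ENNReal.ofReal (1 / (l : ℝ)) * ENNReal.ofReal L) := by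
  obtain ⟨r, e, c, hr, he, horth, hfe⟩ := exists_orthonormal_coordinates hf
  have hac : μ ≪ volume := (Measure.absolutelyContinuous_of_le hμ).trans
    (Measure.smul_absolutelyContinuous)
  have hvol : ∀ᵐ x, ∀ j, f j x = combination e (c j) x := ae_all_iff.2 hfe
  have hbound : ∀ᵐ Y : Fin l → EuclideanSpace ℝ (Fin d) ∂(Measure.pi fun _ => μ),
      fluctuation f q Y ≤ ∑ k, ENNReal.ofReal
        (((1 / (l : ℝ)) * ∑ i, e k (Y i) - ∫ x, e k x * q x) ^ 2) := by
    -- The excess evaluates functions at sample points; absolute continuity of $\mu$ transfers the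
    -- a.e. expansions there.
    have hY : ∀ᵐ Y : Fin l → EuclideanSpace ℝ (Fin d) ∂(Measure.pi fun _ => μ),
        ∀ i j, f j (Y i) = combination e (c j) (Y i) :=
      ae_all_iff.2 fun i => (measurePreserving_eval (fun _ : Fin l => μ) i).quasiMeasurePreserving.ae
        (hac.ae_le hvol)
    filter_upwards [hY] with Y hY
    rw [← ENNReal.ofReal_sum_of_nonneg fun k _ => sq_nonneg _]
    refine iSup_le fun w => ENNReal.ofReal_le_ofReal ?_
    set b : Fin r → ℝ := fun k => ∑ j, (w j : ℝ) * c j k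
    have hex : excess f q Y (fun j => (w j : ℝ)) = excess e q Y b := by
      have hae : ∀ᵐ x, combination f (fun j => (w j : ℝ)) x = combination e b x :=
        hvol.mono fun x hx => combination_eq_combination hx _
      have h1 : ∫ x, combination f (fun j => (w j : ℝ)) x * q x = ∫ x, combination e b x * q x :=
        integral_congr_ae (hae.mono fun x hx => by simp only [hx])
      have h2 : ∫ x, combination f (fun j => (w j : ℝ)) x ^ 2 = ∫ x, combination e b x ^ 2 :=
        integral_congr_ae (hae.mono fun x hx => by simp only [hx])
      have h3 : ∀ i, combination f (fun j => (w j : ℝ)) (Y i) = combination e b (Y i) :=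
        fun i => combination_eq_combination (hY i) _
      simp only [excess, h1, h2, h3]
    rw [hex]
    exact excess_le_of_orthonormal he horth hq b
  have heμ : ∀ k, MemLp (e k) 2 μ := fun k =>
    ((he k).smul_measure ENNReal.ofReal_ne_top).mono_measure hμ
  calc ∫⁻ Y : Fin l → EuclideanSpace ℝ (Fin d), fluctuation f q Y ∂(Measure.pi fun _ => μ)
      ≤ ∫⁻ Y : Fin l → EuclideanSpace ℝ (Fin d), ∑ k, ENNReal.ofReal
        (((1 / (l : ℝ)) * ∑ i, e k (Y i) - ∫ x, e k x * q x) ^ 2) ∂(Measure.pi fun _ => μ) :=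
        lintegral_mono_ae hbound
    _ = ∑ k, ∫⁻ Y : Fin l → EuclideanSpace ℝ (Fin d), ENNReal.ofReal
        (((1 / (l : ℝ)) * ∑ i, e k (Y i) - ∫ x, e k x * q x) ^ 2) ∂(Measure.pi fun _ => μ) := by
        refine lintegral_finsetSum' _ fun k _ => ?_
        have : ∀ i : Fin l, AEMeasurable (fun Y : Fin l → EuclideanSpace ℝ (Fin d) => e k (Y i))
            (Measure.pi fun _ => μ) := fun i =>
          (heμ k).1.aemeasurable.comp_quasiMeasurePreserving
            (measurePreserving_eval (fun _ : Fin l => μ) i).quasiMeasurePreserving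
        exact ((((Finset.aemeasurable_fun_sum _ fun i _ => this i).const_mul _).sub_const _).pow_const
          _).ennreal_ofReal
    _ ≤ ∑ _k : Fin r, ENNReal.ofReal (1 / (l : ℝ)) * ENNReal.ofReal L := by
        refine Finset.sum_le_sum fun k _ => ?_
        refine (lintegral_sampleMean_sub_sq_le hl (heμ k) _).trans ?_
        rw [hμq, sub_self]
        simp only [ne_eq, OfNat.ofNat_ne_zero, not_false_eq_true, zero_pow, ENNReal.ofReal_zero,
          zero_add]
        gcongr
        refine (lintegral_mono' hμ le_rfl).trans ?_
        rw [lintegral_smul_measure, smul_eq_mul,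
          ← ofReal_integral_eq_lintegral_ofReal (he k).integrable_sq
            (ae_of_all _ fun x => sq_nonneg _)]
        have := horth k k
        simp only [if_true, ← sq] at this
        rw [this, ENNReal.ofReal_one, mul_one]
    _ ≤ _ := by
        rw [Finset.sum_const, Finset.card_univ, Fintype.card_fin, nsmul_eq_mul]
        gcongr

end Fluctuation

/-! ### From fixed estimators to averaged, data-split aggregates -/

section Risk

variable {d : ℕ}

theorem memLp_kernelEstimator {K : EuclideanSpace ℝ (Fin d) → ℝ} (hc : Continuous K)
    (hK : MemLp K 2 volume) {m : ℕ} {h : ℝ} (hh : 0 < h)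
    (Y : Fin m → EuclideanSpace ℝ (Fin d)) : MemLp (kernelEstimator K h Y) 2 volume := by
  have h1 : ∀ i, MemLp (fun x => K (h⁻¹ • (Y i - x))) 2 volume := fun i => by
    have h2 : Integrable fun x => K (h⁻¹ • x) ^ 2 :=
      hK.integrable_sq.comp_smul (inv_ne_zero hh.ne')
    rw [memLp_two_iff_integrable_sq (by fun_prop : Continuous _).aestronglyMeasurable]
    exact h2.comp_sub_left (Y i)
  have h2 : MemLp (fun x => ∑ i, K (h⁻¹ • (Y i - x))) 2 volume := memLp_finsetSum _ fun i _ => h1 i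
  exact h2.const_mul (1 / ((m : ℝ) * h ^ d))

/-- Joint measurability is needed for Fubini over the two samples. It is proved for this majorant
because nothing is assumed about the measurability of the aggregates. -/
theorem measurable_fluctuation {α : Type*} [MeasurableSpace α] {M l : ℕ}
    {F : α → Fin M → EuclideanSpace ℝ (Fin d) → ℝ}
    (hF : ∀ j, Measurable fun z : α × EuclideanSpace ℝ (Fin d) => F z.1 j z.2)
    {q : EuclideanSpace ℝ (Fin d) → ℝ} (hq : Measurable q) :
    Measurable fun z : α × (Fin l → EuclideanSpace ℝ (Fin d)) => fluctuation (F z.1) q z.2 := by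
  have hc : ∀ w : Fin M → ℝ, Measurable fun z : α × EuclideanSpace ℝ (Fin d) =>
      combination (F z.1) w z.2 := fun w =>
    Finset.measurable_fun_sum _ fun j _ => (hF j).const_mul _
  refine Measurable.iSup fun w => Measurable.ennreal_ofReal ?_
  set w' : Fin M → ℝ := fun j => (w j : ℝ)
  have h1 : ∀ i : Fin l, Measurable fun z : α × (Fin l → EuclideanSpace ℝ (Fin d)) =>
      combination (F z.1) w' (z.2 i) := fun i =>
    (hc w').comp (measurable_fst.prodMk ((measurable_pi_apply i).comp measurable_snd))
  have h2 : Measurable fun a : α => ∫ x, combination (F a) w' x * q x :=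
    (StronglyMeasurable.integral_prod_right (ν := volume)
      (f := fun a x => combination (F a) w' x * q x)
      ((hc w').mul (hq.comp measurable_snd)).stronglyMeasurable).measurable
  have h3 : Measurable fun a : α => ∫ x, combination (F a) w' x ^ 2 :=
    (StronglyMeasurable.integral_prod_right (ν := volume)
      (f := fun a x => combination (F a) w' x ^ 2)
      ((hc w').pow_const 2).stronglyMeasurable).measurable
  exact ((((Finset.measurable_fun_sum _ fun i _ => h1 i).const_mul _).sub
    (h2.comp measurable_fst)).const_mul _).sub (h3.comp measurable_fst)

theorem measurePreserving_split {n : ℕ} (s : Split n)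
    (μ : Measure (EuclideanSpace ℝ (Fin d))) [SigmaFinite μ] :
    MeasurePreserving (fun X : Fin n → EuclideanSpace ℝ (Fin d) => (training s X, validation s X))
      (Measure.pi fun _ => μ)
      ((Measure.pi fun _ : Fin (trainSize n) => μ).prod
        (Measure.pi fun _ : Fin (validSize n) => μ)) :=
  (measurePreserving_sumPiEquivProdPi fun _ : Fin (trainSize n) ⊕ Fin (validSize n) => μ).comp
    (MeasurePreserving.symm _ (measurePreserving_piCongrLeft (fun _ : Fin n => μ) s))

theorem lintegral_split_le {n : ℕ} (s : Split n) {μ : Measure (EuclideanSpace ℝ (Fin d))}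
    [IsProbabilityMeasure μ] {B : (Fin (trainSize n) → EuclideanSpace ℝ (Fin d)) → ℝ≥0∞}
    {Z : (Fin (trainSize n) → EuclideanSpace ℝ (Fin d)) ×
      (Fin (validSize n) → EuclideanSpace ℝ (Fin d)) → ℝ≥0∞}
    (hB : Measurable B) (hZ : Measurable Z) {c : ℝ≥0∞}
    (hc : ∀ T, ∫⁻ V, Z (T, V) ∂(Measure.pi fun _ => μ) ≤ c) :
    ∫⁻ X, (B (training s X) + Z (training s X, validation s X)) ∂(Measure.pi fun _ => μ) ≤
      (∫⁻ T, B T ∂(Measure.pi fun _ => μ)) + c := by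
  have hBZ : Measurable fun z => B z.1 + Z z := (hB.comp measurable_fst).add hZ
  have h1 := (measurePreserving_split s μ).lintegral_comp hBZ
  rw [lintegral_prod _ hBZ.aemeasurable] at h1
  refine h1.le.trans ?_
  have h2 : ∀ T, ∫⁻ V, (B T + Z (T, V)) ∂(Measure.pi fun _ => μ) ≤ B T + c := fun T => by
    rw [lintegral_add_left measurable_const, lintegral_const, measure_univ, mul_one]
    exact add_le_add le_rfl (hc T)
  refine (lintegral_mono h2).trans_eq ?_
  rw [lintegral_add_right _ measurable_const, lintegral_const, measure_univ, mul_one]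

/-- Each split has the same joint law of training and validation samples, so each term has the same
bound and the average does not see $S$. -/
theorem lintegral_average_splits_le {n : ℕ} {S : Finset (Split n)} (hS : S.Nonempty)
    {μ : Measure (EuclideanSpace ℝ (Fin d))} [IsProbabilityMeasure μ]
    {B : (Fin (trainSize n) → EuclideanSpace ℝ (Fin d)) → ℝ≥0∞}
    {Z : (Fin (trainSize n) → EuclideanSpace ℝ (Fin d)) ×
      (Fin (validSize n) → EuclideanSpace ℝ (Fin d)) → ℝ≥0∞}
    (hB : Measurable B) (hZ : Measurable Z) {c : ℝ≥0∞}
    (hc : ∀ T, ∫⁻ V, Z (T, V) ∂(Measure.pi fun _ => μ) ≤ c) :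
    ∫⁻ X, ENNReal.ofReal (1 / (S.card : ℝ)) *
        ∑ s ∈ S, (B (training s X) + Z (training s X, validation s X))
          ∂(Measure.pi fun _ => μ) ≤
      (∫⁻ T, B T ∂(Measure.pi fun _ => μ)) + c := by
  have hBZ : Measurable fun z => B z.1 + Z z := (hB.comp measurable_fst).add hZ
  have hN : (0 : ℝ) < S.card := by exact_mod_cast hS.card_pos
  have hs : ∀ s ∈ S, Measurable fun X : Fin n → EuclideanSpace ℝ (Fin d) =>
      B (training s X) + Z (training s X, validation s X) := fun s _ =>
    hBZ.comp (measurePreserving_split s μ).measurable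
  rw [lintegral_const_mul' _ _ ENNReal.ofReal_ne_top, lintegral_finsetSum _ hs]
  refine (mul_le_mul_right (Finset.sum_le_sum fun s _ => lintegral_split_le s hB hZ hc)
    _).trans_eq ?_
  rw [Finset.sum_const, nsmul_eq_mul, ← mul_assoc, ← ENNReal.ofReal_natCast S.card,
    ← ENNReal.ofReal_mul (by positivity), one_div_mul_cancel hN.ne', ENNReal.ofReal_one, one_mul]

theorem lintegral_aggregate_sub_sq_le {M l : ℕ} {f : Fin M → EuclideanSpace ℝ (Fin d) → ℝ}
    {q g : EuclideanSpace ℝ (Fin d) → ℝ} {Y : Fin l → EuclideanSpace ℝ (Fin d)} {kind : Kind}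
    (hf : ∀ j, MemLp (f j) 2 volume) (hq : MemLp q 2 volume) (hg : IsAggregate kind f Y g)
    (k : Fin M) :
    MemLp g 2 volume ∧ ∫⁻ x, ENNReal.ofReal ((g x - q x) ^ 2) ≤
      (∫⁻ x, ENNReal.ofReal ((f k x - q x) ^ 2)) + fluctuation f q Y := by
  obtain ⟨w, hgw, hle⟩ := exists_excess_of_isAggregate hf hq hg k
  have hgL : MemLp g 2 volume := by
    rw [hgw]
    exact (hf k).add (memLp_combination hf w)
  have i1 : Integrable fun x => (g x - q x) ^ 2 := (hgL.sub hq).integrable_sq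
  have i2 : Integrable fun x => (f k x - q x) ^ 2 := ((hf k).sub hq).integrable_sq
  refine ⟨hgL, ?_⟩
  rw [← ofReal_integral_eq_lintegral_ofReal i1 (ae_of_all _ fun x => sq_nonneg _),
    ← ofReal_integral_eq_lintegral_ofReal i2 (ae_of_all _ fun x => sq_nonneg _)]
  exact (ENNReal.ofReal_le_ofReal hle).trans
    (ENNReal.ofReal_add_le.trans (add_le_add le_rfl (excess_le_fluctuation hf hq w)))

/-- Convexity of the square, through Cauchy-Schwarz. -/
theorem ofReal_average_sub_sq_le {ι : Type*} {S : Finset ι} (hS : S.Nonempty) (a : ι → ℝ)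
    (b : ℝ) :
    ENNReal.ofReal (((1 / (S.card : ℝ)) * ∑ s ∈ S, a s - b) ^ 2) ≤
      ENNReal.ofReal (1 / (S.card : ℝ)) * ∑ s ∈ S, ENNReal.ofReal ((a s - b) ^ 2) := by
  have hN : (0 : ℝ) < S.card := by exact_mod_cast hS.card_pos
  rw [← ENNReal.ofReal_sum_of_nonneg fun s _ => sq_nonneg _, ← ENNReal.ofReal_mul (by positivity)]
  refine ENNReal.ofReal_le_ofReal ?_
  have h := sq_sum_le_card_mul_sum_sq (s := S) (f := fun s => a s - b)
  have e : (1 / (S.card : ℝ)) * ∑ s ∈ S, a s - b = (1 / (S.card : ℝ)) * ∑ s ∈ S, (a s - b) := by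
    rw [Finset.sum_sub_distrib, Finset.sum_const, nsmul_eq_mul]
    field_simp
  rw [e, mul_pow]
  calc (1 / (S.card : ℝ)) ^ 2 * (∑ s ∈ S, (a s - b)) ^ 2
      ≤ (1 / (S.card : ℝ)) ^ 2 * (S.card * ∑ s ∈ S, (a s - b) ^ 2) := by gcongr
    _ = _ := by field_simp

theorem lintegral_average_sub_sq_le {M n : ℕ} {S : Finset (Split n)} (hS : S.Nonempty)
    {kind : Kind}
    {F : (Fin (trainSize n) → EuclideanSpace ℝ (Fin d)) → Fin M → EuclideanSpace ℝ (Fin d) → ℝ}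
    (hF : ∀ T j, MemLp (F T j) 2 volume) {p q : EuclideanSpace ℝ (Fin d) → ℝ}
    (hq : MemLp q 2 volume) (hpq : p =ᵐ[volume] q) {X : Fin n → EuclideanSpace ℝ (Fin d)}
    {g : Split n → EuclideanSpace ℝ (Fin d) → ℝ}
    (hg : ∀ s ∈ S, IsAggregate kind (F (training s X)) (validation s X) (g s)) (k : Fin M) :
    ∫⁻ x, ENNReal.ofReal (((1 / (S.card : ℝ)) * ∑ s ∈ S, g s x - p x) ^ 2) ≤
      ENNReal.ofReal (1 / (S.card : ℝ)) * ∑ s ∈ S,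
        ((∫⁻ x, ENNReal.ofReal ((F (training s X) k x - q x) ^ 2)) +
          fluctuation (F (training s X)) q (validation s X)) := by
  have hgs := fun s hs => lintegral_aggregate_sub_sq_le (hF (training s X)) hq (hg s hs) k
  calc _ ≤ ∫⁻ x, ENNReal.ofReal (1 / (S.card : ℝ)) *
          ∑ s ∈ S, ENNReal.ofReal ((g s x - q x) ^ 2) := by
        refine lintegral_mono_ae (hpq.mono fun x hx => ?_)
        rw [hx]
        exact ofReal_average_sub_sq_le hS _ _
    _ = ENNReal.ofReal (1 / (S.card : ℝ)) *
          ∑ s ∈ S, ∫⁻ x, ENNReal.ofReal ((g s x - q x) ^ 2) := by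
        rw [lintegral_const_mul' _ _ ENNReal.ofReal_ne_top, lintegral_finsetSum']
        exact fun s hs => (((hgs s hs).1.sub hq).1.aemeasurable.pow_const 2).ennreal_ofReal
    _ ≤ _ := mul_le_mul_right (Finset.sum_le_sum fun s hs => (hgs s hs).2) _

variable {β Q a₀ : ℝ} {p : EuclideanSpace ℝ (Fin d) → ℝ}

theorem memLp_reFourierInv_fourier (hp : p ∈ sobolevClass d β Q) (hβ : (d : ℝ) / 2 < β)
    (hQ : 0 < Q) : MemLp (reFourierInv (fourier p)) 2 volume :=
  memLp_two_of_integrable_of_bound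
    ((integrable_of_mem_sobolevClass hp).congr (ae_eq_reFourierInv_fourier
      (integrable_of_mem_sobolevClass hp) (integrable_fourier hp hβ)))
    (abs_reFourierInv_fourier_le hp hβ hQ)

/-- The oracle inequality for averaged kernel aggregates. -/
theorem risk_averagedKernelAggregate_le (hp : p ∈ sobolevClass d β Q) (hβ : (d : ℝ) / 2 < β)
    (hQ : 0 < Q) {n : ℕ} (hm : 0 < trainSize n) (hl : 0 < validSize n)
    (hbw : ∀ j, 0 < bandwidth d a₀ n j) {kind : Kind} {S : Finset (Split n)} (hS : S.Nonempty)
    {ptilde : (Fin n → EuclideanSpace ℝ (Fin d)) → EuclideanSpace ℝ (Fin d) → ℝ}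
    (hpt : IsAveragedKernelAggregate kind (pinskerKernel d β) a₀ S ptilde)
    (k : Fin (gridSize d a₀ n)) :
    risk ptilde p ≤
      (ENNReal.ofReal (((2 * Real.pi) ^ d)⁻¹ * (Q * bandwidth d a₀ n k ^ (2 * β))) +
        ENNReal.ofReal (1 / (trainSize n : ℝ)) * ENNReal.ofReal (((2 * Real.pi) ^ d)⁻¹ *
          ((bandwidth d a₀ n k ^ d)⁻¹ *
            ∫ t : EuclideanSpace ℝ (Fin d), pinskerFourier β t ^ 2))) +
      gridSize d a₀ n * (ENNReal.ofReal (1 / (validSize n : ℝ)) *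
        ENNReal.ofReal (sobolevSupBound d β Q)) := by
  have hβ0 : 0 < β := lt_of_le_of_lt (by positivity) hβ
  have hpr := isProbabilityMeasure_law hp
  have hae := ae_eq_reFourierInv_fourier (integrable_of_mem_sobolevClass hp)
    (integrable_fourier hp hβ)
  have hcq := continuous_reFourierInv (integrable_fourier hp hβ)
  have hqL := memLp_reFourierInv_fourier hp hβ hQ
  have hlaw : ∀ g : EuclideanSpace ℝ (Fin d) → ℝ, ∫ x, g x ∂(law p) =
      ∫ x, g x * reFourierInv (fourier p) x := fun g => by
    rw [integral_law hp]
    exact integral_congr_ae (hae.mono fun x hx => by simp only [hx])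
  set q := reFourierInv (fourier p)
  have hcE : ∀ j, Continuous fun z : (Fin (trainSize n) → EuclideanSpace ℝ (Fin d)) ×
      EuclideanSpace ℝ (Fin d) =>
        kernelEstimator (pinskerKernel d β) (bandwidth d a₀ n j) z.1 z.2 := fun j =>
    continuous_kernelEstimator (continuous_pinskerKernel hβ0) _
  have hEL : ∀ T j, MemLp (kernelEstimator (m := trainSize n) (pinskerKernel d β)
      (bandwidth d a₀ n j) T) 2 volume := fun T j =>
    memLp_kernelEstimator (continuous_pinskerKernel hβ0) (memLp_pinskerKernel hβ0) (hbw j) T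
  let F : (Fin (trainSize n) → EuclideanSpace ℝ (Fin d)) → Fin (gridSize d a₀ n) →
      EuclideanSpace ℝ (Fin d) → ℝ := fun T j =>
    kernelEstimator (pinskerKernel d β) (bandwidth d a₀ n j) T
  have hBm : Measurable fun T => ∫⁻ x, ENNReal.ofReal ((F T k x - q x) ^ 2) :=
    Measurable.lintegral_prod_right' (f := fun z : (Fin (trainSize n) →
      EuclideanSpace ℝ (Fin d)) × EuclideanSpace ℝ (Fin d) =>
      ENNReal.ofReal ((F z.1 k z.2 - q z.2) ^ 2))
      (((hcE k).sub (hcq.comp continuous_snd)).pow 2).measurable.ennreal_ofReal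
  have hZm : Measurable fun z : (Fin (trainSize n) → EuclideanSpace ℝ (Fin d)) ×
      (Fin (validSize n) → EuclideanSpace ℝ (Fin d)) => fluctuation (F z.1) q z.2 :=
    measurable_fluctuation (fun j => (hcE j).measurable) hcq.measurable
  have hloss : ∀ X, ∫⁻ x, ENNReal.ofReal ((ptilde X x - p x) ^ 2) ≤
      ENNReal.ofReal (1 / (S.card : ℝ)) * ∑ s ∈ S,
        ((∫⁻ x, ENNReal.ofReal ((F (training s X) k x - q x) ^ 2)) +
          fluctuation (F (training s X)) q (validation s X)) := by
    intro X
    obtain ⟨g, hg, hptX⟩ := hpt X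
    rw [hptX]
    exact lintegral_average_sub_sq_le (F := F) hS hEL hqL hae hg k
  have hc : ∀ T, ∫⁻ V : Fin (validSize n) → EuclideanSpace ℝ (Fin d),
      fluctuation (F T) q V ∂(Measure.pi fun _ => law p) ≤
      gridSize d a₀ n * (ENNReal.ofReal (1 / (validSize n : ℝ)) *
        ENNReal.ofReal (sobolevSupBound d β Q)) := fun T =>
    lintegral_fluctuation_le (law_le hp hβ hQ) hlaw (hEL T) hqL hl
  have h2 := lintegral_average_splits_le hS hBm hZm hc
  have h3 := lintegral_kernelEstimator_sub_sq_le hp hβ hm (hbw k)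
  -- Monotonicity of the lower integral requires no measurability of `ptilde`.
  exact (lintegral_mono hloss).trans (h2.trans (add_le_add h3 le_rfl))

end Risk

/-! ### Geometry and size of the bandwidth grid -/

section Grid

variable {d : ℕ} {a₀ : ℝ} {n : ℕ}

/-- Without boundedness the `sSup` in `gridSize` would be the default value 0. -/
theorem bddAbove_grid (h0 : 0 < minBandwidth d n) (ha : 0 < gridStep a₀ n) :
    BddAbove {j : ℕ | minBandwidth d n * (1 + gridStep a₀ n) ^ j < 1} := by
  obtain ⟨N, hN⟩ := pow_unbounded_of_one_lt (1 / minBandwidth d n)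
    (by linarith : 1 < 1 + gridStep a₀ n)
  refine ⟨N, fun j hj => ?_⟩
  by_contra hlt
  push Not at hlt
  have h1 : (1 + gridStep a₀ n) ^ N ≤ (1 + gridStep a₀ n) ^ j :=
    pow_le_pow_right₀ (by linarith) hlt.le
  have h2 : 1 < minBandwidth d n * (1 + gridStep a₀ n) ^ j := by
    rw [div_lt_iff₀ h0] at hN
    nlinarith
  exact absurd hj (not_lt.2 h2.le)

theorem bandwidth_pos (h0 : 0 < minBandwidth d n) (ha : 0 < gridStep a₀ n)
    (j : Fin (gridSize d a₀ n)) : 0 < bandwidth d a₀ n j := by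
  unfold bandwidth
  split_ifs
  · exact one_pos
  · positivity

theorem exists_bandwidth_near (h0 : 0 < minBandwidth d n) (ha : 0 < gridStep a₀ n) {t : ℝ}
    (ht : minBandwidth d n ≤ t) (ht1 : t < 1) :
    ∃ k, bandwidth d a₀ n k ≤ t ∧ t ≤ (1 + gridStep a₀ n) * bandwidth d a₀ n k := by
  obtain ⟨j, hj1, hj2⟩ := exists_nat_pow_near ((one_le_div h0).2 ht)
    (by linarith : 1 < 1 + gridStep a₀ n)
  rw [le_div_iff₀ h0] at hj1
  rw [div_lt_iff₀ h0] at hj2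
  have hmem : j ∈ {j : ℕ | minBandwidth d n * (1 + gridStep a₀ n) ^ j < 1} := by
    change minBandwidth d n * (1 + gridStep a₀ n) ^ j < 1
    linarith
  have hle : j ≤ sSup {j : ℕ | minBandwidth d n * (1 + gridStep a₀ n) ^ j < 1} :=
    le_csSup (bddAbove_grid h0 ha) hmem
  -- The `+ 2` in `gridSize` leaves $j$ strictly below the last index, which carries bandwidth 1
  -- instead of a geometric value.
  have hlt : j + 1 < gridSize d a₀ n := by unfold gridSize; omega
  refine ⟨⟨j, by omega⟩, ?_⟩
  rw [bandwidth, if_neg hlt.ne]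
  refine ⟨hj1, hj2.le.trans_eq ?_⟩
  simp only [pow_succ]
  ring

/-- Taking logarithms in $h_0(1+a_n)^j<1$ gives $j\log(1+a_n)\le\frac1d(\log n+\log\log n)\le2\log
n$, while $\log(1+a)\ge2a/(a+2)\ge a/2$ for $0\le a\le2$. -/
theorem gridSize_le (hd : 1 ≤ d) (ha₀ : 0 < a₀) (hn : 1 ≤ Real.log n)
    (ha : gridStep a₀ n ≤ 2) :
    (gridSize d a₀ n : ℝ) ≤ 2 + 4 / a₀ * Real.log n ^ 2 := by
  have hlog0 : 0 < Real.log n := by linarith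
  have hn1 : (1 : ℝ) < n := by
    by_contra h
    linarith [Real.log_nonpos (Nat.cast_nonneg n) (not_lt.1 h)]
  have hpos : 0 < (n : ℝ) * Real.log n := by positivity
  have h0 : 0 < minBandwidth d n := Real.rpow_pos_of_pos hpos _
  have ha0 : 0 < gridStep a₀ n := div_pos ha₀ hlog0
  have hd1 : (1 : ℝ) ≤ d := by exact_mod_cast hd
  have hh : minBandwidth d n < 1 := by
    refine Real.rpow_lt_one_of_one_lt_of_neg (by nlinarith) ?_
    exact div_neg_of_neg_of_pos (by norm_num) (by linarith)
  set J := {j : ℕ | minBandwidth d n * (1 + gridStep a₀ n) ^ j < 1} with hJ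
  have hmem : sSup J ∈ J := Nat.sSup_mem ⟨0, by simpa [hJ] using hh⟩ (bddAbove_grid h0 ha0)
  have hlt : minBandwidth d n * (1 + gridStep a₀ n) ^ sSup J < 1 := hmem
  have hlogle := Real.log_nonpos (by positivity) hlt.le
  rw [Real.log_mul h0.ne' (by positivity), Real.log_pow, minBandwidth, Real.log_rpow hpos,
    Real.log_mul (by positivity) hlog0.ne'] at hlogle
  have hll : Real.log (Real.log n) ≤ Real.log n := by
    have := Real.log_le_sub_one_of_pos hlog0
    linarith
  have hll0 : 0 ≤ Real.log (Real.log n) := Real.log_nonneg hn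
  have h1 : ((sSup J : ℕ) : ℝ) * Real.log (1 + gridStep a₀ n) ≤ 2 * Real.log n := by
    have : 1 / (d : ℝ) * (Real.log n + Real.log (Real.log n)) ≤ 1 * (2 * Real.log n) := by
      have : 1 / (d : ℝ) ≤ 1 := (div_le_one (by linarith)).2 hd1
      apply mul_le_mul this (by linarith) (by linarith) (by norm_num)
    have e : -1 / (d : ℝ) = -(1 / (d : ℝ)) := by ring
    rw [e] at hlogle
    linarith
  have h2 : gridStep a₀ n / 2 ≤ Real.log (1 + gridStep a₀ n) := by
    refine le_trans ?_ (Real.le_log_one_add_of_nonneg ha0.le)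
    rw [div_le_div_iff₀ (by norm_num) (by linarith)]
    nlinarith
  have h3 : ((sSup J : ℕ) : ℝ) * (gridStep a₀ n / 2) ≤ 2 * Real.log n :=
    (mul_le_mul_of_nonneg_left h2 (Nat.cast_nonneg _)).trans h1
  have h4 : ((sSup J : ℕ) : ℝ) ≤ 4 / a₀ * Real.log n ^ 2 := by
    rw [gridStep] at h3
    have : ((sSup J : ℕ) : ℝ) * (a₀ / Real.log n / 2) = ((sSup J : ℕ) : ℝ) * a₀ / (2 * Real.log n) := by
      field_simp
    rw [this, div_le_iff₀ (by positivity)] at h3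
    rw [div_mul_eq_mul_div, le_div_iff₀ ha₀]
    nlinarith
  have : (gridSize d a₀ n : ℝ) = ((sSup J : ℕ) : ℝ) + 2 := by
    rw [gridSize]; push_cast; rfl
  linarith

end Grid

/-! ### Sample sizes and negligibility of the aggregation cost -/

section Asymptotics

theorem tendsto_log_natCast : Tendsto (fun n : ℕ => Real.log n) atTop atTop :=
  Real.tendsto_log_atTop.comp tendsto_natCast_atTop_atTop

theorem tendsto_gridStep (a₀ : ℝ) : Tendsto (gridStep a₀) atTop (𝓝 0) :=
  tendsto_log_natCast.const_div_atTop a₀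

theorem tendsto_trainSize_div : Tendsto (fun n : ℕ => (trainSize n : ℝ) / n) atTop (𝓝 1) := by
  have h1 : Tendsto (fun n : ℕ => 1 - 1 / Real.log n - 1 / (n : ℝ)) atTop (𝓝 1) := by
    have := (tendsto_log_natCast.const_div_atTop 1).const_sub 1
    simpa using this.sub (tendsto_natCast_atTop_atTop (R := ℝ).const_div_atTop 1)
  refine tendsto_of_tendsto_of_tendsto_of_le_of_le' h1 tendsto_const_nhds ?_ ?_
  · filter_upwards [eventually_gt_atTop 0] with n hn
    have hn0 : (0 : ℝ) < n := by exact_mod_cast hn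
    rw [le_div_iff₀ hn0]
    have := (Nat.lt_floor_add_one ((n : ℝ) * (1 - 1 / Real.log n))).le
    have e : (1 - 1 / Real.log n - 1 / (n : ℝ)) * n = n * (1 - 1 / Real.log n) - 1 := by
      field_simp
    rw [e, trainSize]
    linarith
  · filter_upwards [eventually_gt_atTop 0, tendsto_log_natCast.eventually_ge_atTop 1] with n hn hl
    have hn0 : (0 : ℝ) < n := by exact_mod_cast hn
    have h2 : 1 / Real.log n ≤ 1 := (div_le_one (by linarith)).2 hl
    have h3 : (0 : ℝ) ≤ 1 / Real.log n := by positivity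
    rw [div_le_one hn0]
    refine (Nat.floor_le (mul_nonneg hn0.le (by linarith))).trans ?_
    nlinarith

theorem div_log_le_validSize {n : ℕ} (hl : 1 ≤ Real.log n) :
    (n : ℝ) / Real.log n ≤ validSize n := by
  have h2 : 1 / Real.log n ≤ 1 := (div_le_one (by linarith)).2 hl
  have h3 : (0 : ℝ) ≤ 1 / Real.log n := by positivity
  have hn0 : (0 : ℝ) ≤ n := Nat.cast_nonneg n
  have h4 : (trainSize n : ℝ) ≤ n * (1 - 1 / Real.log n) :=
    Nat.floor_le (mul_nonneg hn0 (by linarith))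
  have h5 : trainSize n ≤ n := by
    have : (trainSize n : ℝ) ≤ n := by nlinarith
    exact_mod_cast this
  rw [validSize, Nat.cast_sub h5]
  have : (n : ℝ) / Real.log n = n * (1 / Real.log n) := by ring
  linarith

theorem tendsto_log_pow_mul_rpow_neg (k : ℕ) {s : ℝ} (hs : 0 < s) :
    Tendsto (fun n : ℕ => Real.log n ^ k * (n : ℝ) ^ (-s)) atTop (𝓝 0) := by
  have h := (isLittleO_log_rpow_rpow_atTop (k : ℝ) hs).tendsto_div_nhds_zero.comp
    (tendsto_natCast_atTop_atTop (R := ℝ))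
  refine h.congr fun n => ?_
  simp only [Function.comp, Real.rpow_natCast]
  rw [Real.rpow_neg (Nat.cast_nonneg n), div_eq_mul_inv]

/-- Here $M=O(\log^2n)$ and $1/\ell\le\log n/n$, so $M/\ell=O(\log^3n/n)$, which is $o(n^{-s})$ for
every $s<1$. -/
theorem tendsto_gridSize_div_validSize {d : ℕ} (hd : 1 ≤ d) {a₀ s : ℝ} (ha₀ : 0 < a₀)
    (hs : s < 1) :
    Tendsto (fun n : ℕ => (gridSize d a₀ n : ℝ) * (1 / (validSize n : ℝ)) * (n : ℝ) ^ s)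
      atTop (𝓝 0) := by
  have h1 : Tendsto (fun n : ℕ => 2 * (Real.log n ^ 1 * (n : ℝ) ^ (-(1 - s))) +
      4 / a₀ * (Real.log n ^ 3 * (n : ℝ) ^ (-(1 - s)))) atTop (𝓝 0) := by
    have := ((tendsto_log_pow_mul_rpow_neg 1 (sub_pos.2 hs)).const_mul 2).add
      ((tendsto_log_pow_mul_rpow_neg 3 (sub_pos.2 hs)).const_mul (4 / a₀))
    simpa only [mul_zero, add_zero] using this
  refine tendsto_of_tendsto_of_tendsto_of_le_of_le' tendsto_const_nhds h1
    (Eventually.of_forall fun n => by positivity) ?_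
  filter_upwards [eventually_gt_atTop 0, tendsto_log_natCast.eventually_ge_atTop 1,
    (tendsto_gridStep a₀).eventually_le_const (by norm_num : (0 : ℝ) < 2)] with n hn hl ha
  have hn0 : (0 : ℝ) < n := by exact_mod_cast hn
  have hv := div_log_le_validSize hl
  have hv' : 1 / (validSize n : ℝ) ≤ Real.log n / n := by
    have := one_div_le_one_div_of_le (by positivity) hv
    rwa [one_div_div] at this
  have hg := gridSize_le hd ha₀ hl ha
  have he : (n : ℝ) ^ (-(1 - s)) = (n : ℝ) ^ s / n := by
    rw [show -(1 - s) = s - 1 by ring, Real.rpow_sub hn0, Real.rpow_one]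
  calc (gridSize d a₀ n : ℝ) * (1 / (validSize n : ℝ)) * (n : ℝ) ^ s
      ≤ (2 + 4 / a₀ * Real.log n ^ 2) * (Real.log n / n) * (n : ℝ) ^ s := by gcongr
    _ = _ := by rw [he]; ring

end Asymptotics

/-! ### Optimal bandwidth, sharp constant and rate -/

section Rate

/-- The constant factor of the optimal bandwidth. -/
def oracleFactor (d : ℕ) (β Q : ℝ) : ℝ :=
  (β * sphereArea d / (β + d) / (Q * (2 * β + d))) ^ (1 / (2 * β + (d : ℝ)))

/-- The optimal bandwidth of the Pinsker kernel estimator over the Sobolev class. -/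
def oracleBandwidth (d : ℕ) (β Q : ℝ) (n : ℕ) : ℝ :=
  oracleFactor d β Q * (n : ℝ) ^ (-(1 / (2 * β + (d : ℝ))))

/-- The bound for the risk of averaged kernel aggregates that results from the optimal bandwidth. -/
def riskBound (d : ℕ) (β Q a₀ : ℝ) (n : ℕ) : ℝ :=
  ((2 * Real.pi) ^ d)⁻¹ * (Q * oracleBandwidth d β Q n ^ (2 * β)) +
    1 / (trainSize n : ℝ) * (((2 * Real.pi) ^ d)⁻¹ *
      ((1 + gridStep a₀ n) ^ d * (oracleBandwidth d β Q n ^ d)⁻¹ *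
        ∫ t : EuclideanSpace ℝ (Fin d), pinskerFourier β t ^ 2)) +
    gridSize d a₀ n * (1 / (validSize n : ℝ) * sobolevSupBound d β Q)

variable {d : ℕ} {β Q a₀ : ℝ}

theorem sphereArea_pos (hd : 1 ≤ d) : 0 < sphereArea d := by
  have hd0 : (0 : ℝ) < d := by exact_mod_cast hd
  have := Real.Gamma_pos_of_pos (show 0 < (d : ℝ) / 2 by positivity)
  have := Real.pi_pos
  unfold sphereArea
  positivity

theorem oracleFactor_pos (hd : 1 ≤ d) (hβ : 0 < β) (hQ : 0 < Q) : 0 < oracleFactor d β Q := by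
  have := sphereArea_pos hd
  unfold oracleFactor
  positivity

theorem pinskerConst_pos (hd : 1 ≤ d) (hβ : 0 < β) (hQ : 0 < Q) : 0 < pinskerConst d β Q := by
  have := sphereArea_pos hd
  have := Real.pi_pos
  have hd0 : (0 : ℝ) < d := by exact_mod_cast hd
  unfold pinskerConst
  positivity

/-- The factor $c$ minimizes $Qc^{2\beta}+Ic^{-d}$: stationarity is $c^{2\beta+d}=dI/(2\beta Q)$.
The variance part is then $2\beta/d$ times the bias part, and the sum is $Q(2\beta+d)c^{2\beta}/d$.
-/
theorem pinskerConst_eq (hd : 1 ≤ d) (hβ : 0 < β) (hQ : 0 < Q) :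
    ((2 * Real.pi) ^ d)⁻¹ * (Q * oracleFactor d β Q ^ (2 * β)) +
      ((2 * Real.pi) ^ d)⁻¹ * ((oracleFactor d β Q ^ d)⁻¹ *
        ∫ t : EuclideanSpace ℝ (Fin d), pinskerFourier β t ^ 2) = pinskerConst d β Q := by
  have hd0 : (0 : ℝ) < d := by exact_mod_cast hd
  have hpi := Real.pi_pos
  have hS := sphereArea_pos hd
  have hc := oracleFactor_pos hd hβ hQ
  rw [integral_pinskerFourier_sq hd hβ, pinskerConst]
  set A := β * sphereArea d / (β + d) with hA
  set R := Q * (2 * β + d) with hR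
  have hA0 : 0 < A := by positivity
  have hR0 : 0 < R := by positivity
  have hN : 0 < 2 * β + (d : ℝ) := by positivity
  set c := oracleFactor d β Q with hcdef
  have hcA : c = (A / R) ^ (1 / (2 * β + (d : ℝ))) := rfl
  have h1 : c ^ (2 * β) = A ^ (2 * β / (2 * β + d)) / R ^ (2 * β / (2 * β + d)) := by
    rw [hcA, ← Real.rpow_mul (by positivity), Real.div_rpow hA0.le hR0.le]
    congr 2 <;> ring
  have h2 : c ^ (2 * β) * c ^ d = A / R := by
    rw [← Real.rpow_natCast c d, ← Real.rpow_add hc, hcA, ← Real.rpow_mul (by positivity),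
      one_div_mul_cancel hN.ne', Real.rpow_one]
  have h3 : (c ^ d)⁻¹ = c ^ (2 * β) * (R / A) := by
    rw [eq_comm, ← one_div, eq_div_iff (by positivity)]
    calc c ^ (2 * β) * (R / A) * c ^ d = (c ^ (2 * β) * c ^ d) * (R / A) := by ring
      _ = 1 := by rw [h2]; field_simp
  have h4 : R ^ ((d : ℝ) / (2 * β + d)) = R / R ^ (2 * β / (2 * β + d)) := by
    rw [eq_div_iff (by positivity), ← Real.rpow_add hR0, ← add_div, add_comm (d : ℝ),
      div_self hN.ne', Real.rpow_one]
  have hI : sphereArea d * (2 * β ^ 2 / (d * (β + d) * (2 * β + d))) =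
      A * (2 * β / (d * (2 * β + d))) := by
    rw [hA]; field_simp
  have hRQ : R * (2 * β / (d * (2 * β + d))) = Q * (2 * β / d) := by
    rw [hR]; field_simp
  have h5 : (c ^ d)⁻¹ * (A * (2 * β / (d * (2 * β + d)))) = c ^ (2 * β) * (Q * (2 * β / d)) := by
    rw [h3, ← hRQ]; field_simp
  rw [hI, h5, h4]
  have h6 : R / R ^ (2 * β / (2 * β + d)) / (d * (2 * Real.pi) ^ d) * A ^ (2 * β / (2 * β + d)) =
      ((2 * Real.pi) ^ d)⁻¹ * (R / d * c ^ (2 * β)) := by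
    rw [h1]; field_simp
  rw [h6, hR]
  field_simp
  ring

theorem oracleBandwidth_rpow (hd : 1 ≤ d) (hβ : 0 < β) (hQ : 0 < Q) (n : ℕ) :
    oracleBandwidth d β Q n ^ (2 * β) =
      oracleFactor d β Q ^ (2 * β) * (n : ℝ) ^ (-(2 * β / (2 * β + (d : ℝ)))) := by
  rw [oracleBandwidth, Real.mul_rpow (oracleFactor_pos hd hβ hQ).le (by positivity),
    ← Real.rpow_mul (Nat.cast_nonneg n)]
  congr 2
  ring

/-- Writing the power as $n\cdot n^{-2\beta/(2\beta+d)}$ isolates the factor $n$ that meets $1/m$ in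
the variance. -/
theorem oracleBandwidth_pow_inv (hβ : 0 < β) {n : ℕ} (hn : 0 < n) :
    (oracleBandwidth d β Q n ^ d)⁻¹ =
      (oracleFactor d β Q ^ d)⁻¹ * (n * (n : ℝ) ^ (-(2 * β / (2 * β + (d : ℝ))))) := by
  have hn0 : (0 : ℝ) < n := by exact_mod_cast hn
  have hN : 0 < 2 * β + (d : ℝ) := by positivity
  rw [oracleBandwidth, mul_pow, mul_inv, ← Real.rpow_natCast ((n : ℝ) ^ _) d,
    ← Real.rpow_mul hn0.le, ← Real.rpow_neg hn0.le]
  congr 1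
  nth_rw 2 [← Real.rpow_one (n : ℝ)]
  rw [← Real.rpow_add hn0]
  congr 1
  field_simp
  ring

theorem tendsto_riskBound_mul (hd : 1 ≤ d) (hβ : (d : ℝ) / 2 < β) (hQ : 0 < Q) (ha₀ : 0 < a₀) :
    Tendsto (fun n : ℕ => riskBound d β Q a₀ n * (n : ℝ) ^ (2 * β / (2 * β + (d : ℝ)))) atTop
      (𝓝 (pinskerConst d β Q)) := by
  have hd0 : (0 : ℝ) < d := by exact_mod_cast hd
  have hβ0 : 0 < β := lt_of_le_of_lt (by positivity) hβ
  rw [← pinskerConst_eq hd hβ0 hQ]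
  set I := ∫ t : EuclideanSpace ℝ (Fin d), pinskerFourier β t ^ 2
  set c := oracleFactor d β Q
  set s := 2 * β / (2 * β + (d : ℝ)) with hs
  have hs1 : s < 1 := (div_lt_one (by positivity)).2 (by linarith)
  have hlim : Tendsto (fun n : ℕ => ((2 * Real.pi) ^ d)⁻¹ * (Q * c ^ (2 * β)) +
      ((trainSize n : ℝ) / n)⁻¹ * (1 + gridStep a₀ n) ^ d *
        (((2 * Real.pi) ^ d)⁻¹ * ((c ^ d)⁻¹ * I)) +
      ((gridSize d a₀ n : ℝ) * (1 / (validSize n : ℝ)) * (n : ℝ) ^ s) * sobolevSupBound d β Q)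
      atTop (𝓝 (((2 * Real.pi) ^ d)⁻¹ * (Q * c ^ (2 * β)) +
        ((1 : ℝ)⁻¹ * (1 + 0) ^ d) * (((2 * Real.pi) ^ d)⁻¹ * ((c ^ d)⁻¹ * I)) +
        0 * sobolevSupBound d β Q)) :=
    ((((tendsto_trainSize_div.inv₀ one_ne_zero).mul
      (((tendsto_gridStep a₀).const_add 1).pow d)).mul_const _).const_add _).add
      ((tendsto_gridSize_div_validSize hd ha₀ hs1).mul_const _)
  simp only [add_zero, inv_one, one_pow, one_mul, zero_mul] at hlim
  refine hlim.congr' ?_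
  filter_upwards [eventually_gt_atTop 0] with n hn
  have hn0 : (0 : ℝ) < n := by exact_mod_cast hn
  have hns : (n : ℝ) ^ (-s) * (n : ℝ) ^ s = 1 := by
    rw [← Real.rpow_add hn0, neg_add_cancel, Real.rpow_zero]
  rw [riskBound, oracleBandwidth_rpow hd hβ0 hQ, oracleBandwidth_pow_inv hβ0 hn, ← hs, inv_div]
  set v := (n : ℝ) ^ (-s)
  set u := (n : ℝ) ^ s
  linear_combination (-(((2 * Real.pi) ^ d)⁻¹ * (Q * c ^ (2 * β))) -
    ((n : ℝ) / trainSize n) * (1 + gridStep a₀ n) ^ d *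
        (((2 * Real.pi) ^ d)⁻¹ * ((c ^ d)⁻¹ * I))) * hns

/-- The exponents compare as $1/d>1/(2\beta+d)$, and the logarithm only makes $h_0$ smaller. -/
theorem eventually_minBandwidth_le (hd : 1 ≤ d) (hβ : 0 < β) (hQ : 0 < Q) :
    ∀ᶠ n : ℕ in atTop, minBandwidth d n ≤ oracleBandwidth d β Q n := by
  have hd0 : (0 : ℝ) < d := by exact_mod_cast hd
  have hN : 0 < 2 * β + (d : ℝ) := by positivity
  have hs : 0 < 1 / (d : ℝ) - 1 / (2 * β + d) := by
    rw [sub_pos]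
    exact one_div_lt_one_div_of_lt hd0 (by linarith)
  have ht : Tendsto (fun n : ℕ => (n : ℝ) ^ (-(1 / (d : ℝ) - 1 / (2 * β + d)))) atTop (𝓝 0) :=
    (tendsto_rpow_neg_atTop hs).comp tendsto_natCast_atTop_atTop
  filter_upwards [ht.eventually_le_const (oracleFactor_pos hd hβ hQ), eventually_gt_atTop 0,
    tendsto_log_natCast.eventually_ge_atTop 1] with n h1 hn hl
  have hn0 : (0 : ℝ) < n := by exact_mod_cast hn
  calc minBandwidth d n ≤ (n : ℝ) ^ (-1 / (d : ℝ)) :=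
        Real.rpow_le_rpow_of_nonpos hn0 (by nlinarith)
          (div_nonpos_of_nonpos_of_nonneg (by norm_num) hd0.le)
    _ = (n : ℝ) ^ (-(1 / (d : ℝ) - 1 / (2 * β + d))) * (n : ℝ) ^ (-(1 / (2 * β + (d : ℝ)))) := by
        rw [← Real.rpow_add hn0]
        congr 1; ring
    _ ≤ _ := by
        rw [oracleBandwidth]
        gcongr

theorem eventually_oracleBandwidth_lt_one (hβ : 0 < β) :
    ∀ᶠ n : ℕ in atTop, oracleBandwidth d β Q n < 1 := by
  have ht : Tendsto (oracleBandwidth d β Q) atTop (𝓝 (oracleFactor d β Q * 0)) :=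
    ((tendsto_rpow_neg_atTop (by positivity : 0 < 1 / (2 * β + (d : ℝ)))).comp
      tendsto_natCast_atTop_atTop).const_mul _
  rw [mul_zero] at ht
  exact ht.eventually_lt_const one_pos

theorem eventually_risk_le_riskBound (hd : 1 ≤ d) (hβ : (d : ℝ) / 2 < β) (hQ : 0 < Q)
    (ha₀ : 0 < a₀) :
    ∀ᶠ n : ℕ in atTop, ∀ (kind : Kind) (S : Finset (Split n)), S.Nonempty →
      ∀ ptilde : (Fin n → EuclideanSpace ℝ (Fin d)) → EuclideanSpace ℝ (Fin d) → ℝ,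
        IsAveragedKernelAggregate kind (pinskerKernel d β) a₀ S ptilde →
        ∀ p ∈ sobolevClass d β Q, risk ptilde p ≤ ENNReal.ofReal (riskBound d β Q a₀ n) := by
  have hd0 : (0 : ℝ) < d := by exact_mod_cast hd
  have hβ0 : 0 < β := lt_of_le_of_lt (by positivity) hβ
  filter_upwards [eventually_minBandwidth_le hd hβ0 hQ,
    eventually_oracleBandwidth_lt_one (d := d) (Q := Q) hβ0, eventually_gt_atTop 0,
    tendsto_log_natCast.eventually_ge_atTop 1,
    tendsto_trainSize_div.eventually_const_lt one_pos] with n h0 h1 hn hl hm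
    kind S hS ptilde hpt p hp
  have hpi := Real.pi_pos
  have hn0 : (0 : ℝ) < n := by exact_mod_cast hn
  have hlog : 0 < Real.log n := by linarith
  have hmin : 0 < minBandwidth d n := Real.rpow_pos_of_pos (by positivity) _
  have ha : 0 < gridStep a₀ n := div_pos ha₀ hlog
  have hm0 : 0 < trainSize n := by
    rcases Nat.eq_zero_or_pos (trainSize n) with h | h
    · rw [h] at hm; simp at hm
    · exact h
  have hv0 : 0 < validSize n := by
    have : (0 : ℝ) < validSize n := lt_of_lt_of_le (by positivity) (div_log_le_validSize hl)
    exact_mod_cast this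
  -- The index $k$ depends on $n$ and the class but not on $p$, $S$ or the sample, whence the
  -- uniformity.
  obtain ⟨k, hk1, hk2⟩ := exists_bandwidth_near hmin ha h0 h1
  have hk0 := bandwidth_pos hmin ha k
  have hL : 0 ≤ sobolevSupBound d β Q :=
    (abs_nonneg _).trans (abs_reFourierInv_fourier_le hp hβ hQ 0)
  have hI : 0 ≤ ∫ t : EuclideanSpace ℝ (Fin d), pinskerFourier β t ^ 2 :=
    integral_nonneg fun t => sq_nonneg _
  have hob : 0 < oracleBandwidth d β Q n := hmin.trans_le h0
  refine (risk_averagedKernelAggregate_le hp hβ hQ hm0 hv0 (bandwidth_pos hmin ha) hS hpt k).trans ?_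
  rw [← ENNReal.ofReal_mul (by positivity), ← ENNReal.ofReal_mul (by positivity),
    ← ENNReal.ofReal_natCast (gridSize d a₀ n), ← ENNReal.ofReal_mul (by positivity),
    ← ENNReal.ofReal_add (by positivity) (by positivity),
    ← ENNReal.ofReal_add (by positivity) (by positivity)]
  refine ENNReal.ofReal_le_ofReal ?_
  unfold riskBound
  -- The upper half of the bracketing controls the variance; `hk1` controls the bias.
  have hinv : (bandwidth d a₀ n k ^ d)⁻¹ ≤
      (1 + gridStep a₀ n) ^ d * (oracleBandwidth d β Q n ^ d)⁻¹ := by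
    rw [← div_eq_mul_inv, ← one_div, div_le_div_iff₀ (by positivity) (by positivity), one_mul,
      ← mul_pow]
    exact pow_le_pow_left₀ hob.le hk2 d
  gcongr

end Rate

end DensityAgg

end

/-- The remainder `r`, which is the `o(1)`, and the rank from which the bound holds are uniform
over the kind of aggregation and over the nonempty sets `S` of splits. -/
theorem corollary6p1 (d : ℕ) (hd : 1 ≤ d) (β : ℝ) (hβ : (d : ℝ) / 2 < β) (Q : ℝ) (hQ : 0 < Q)
    (a₀ : ℝ) (ha₀ : 0 < a₀) :
    ∃ r : ℕ → ℝ, Tendsto r atTop (𝓝 0) ∧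
      ∀ᶠ n : ℕ in atTop, ∀ (kind : DensityAgg.Kind) (S : Finset (DensityAgg.Split n)),
        S.Nonempty →
        ∀ ptilde : (Fin n → EuclideanSpace ℝ (Fin d)) → EuclideanSpace ℝ (Fin d) → ℝ,
          DensityAgg.IsAveragedKernelAggregate kind (DensityAgg.pinskerKernel d β) a₀ S ptilde →
          (⨆ p ∈ DensityAgg.sobolevClass d β Q, DensityAgg.risk ptilde p) ≤
            ENNReal.ofReal (DensityAgg.pinskerConst d β Q *
              (n : ℝ) ^ (-(2 * β) / (2 * β + d)) * (1 + r n)) := by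
  have hβ0 : 0 < β := lt_of_le_of_lt (by positivity) hβ
  have hC := DensityAgg.pinskerConst_pos hd hβ0 hQ
  -- The remainder is defined so that $C^*n^{-2\beta/(2\beta+d)}(1+r_n)$ equals `riskBound` exactly
  -- for $n>0$.
  refine ⟨fun n => DensityAgg.riskBound d β Q a₀ n * (n : ℝ) ^ (2 * β / (2 * β + (d : ℝ))) /
    DensityAgg.pinskerConst d β Q - 1, ?_, ?_⟩
  · have h := ((DensityAgg.tendsto_riskBound_mul hd hβ hQ ha₀).div_const
      (DensityAgg.pinskerConst d β Q)).sub_const 1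
    rwa [div_self hC.ne', sub_self] at h
  · filter_upwards [DensityAgg.eventually_risk_le_riskBound hd hβ hQ ha₀,
      eventually_gt_atTop 0] with n h hn kind S hS ptilde hpt
    have hn0 : (0 : ℝ) < n := by exact_mod_cast hn
    refine iSup₂_le fun p hp => (h kind S hS ptilde hpt p hp).trans_eq ?_
    congr 1
    rw [neg_div, add_sub_cancel, Real.rpow_neg hn0.le]
    have := Real.rpow_pos_of_pos hn0 (2 * β / (2 * β + (d : ℝ)))
    field_simp
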